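/- Notation. A sequence $\{d_{n+1}\}_{n\ge1}$ is a positive chain sequence if there is a parameter sequence $\{g_n\}_{n\ge 1}$, with $0\le g_1<1$ and $0<g_n<1$ for $n\ge2$, such that $d_{n+1}=(1-g_n)g_{n+1}$ for all $n\ge1$; it is non single parameter (non SP) if it has more than one parameter sequence. A sequence $\{q_{n+1}\}_{n\ge1}$ with $0<q_{n+1}\le1$ is a scaling sequence for $\{d_{n+1}\}$ if $\{d_{n+1}/q_{n+1}\}_{n\ge1}$ is also a positive chain sequence. For $0<\vartheta_2-\vartheta_1\le2\pi$ put $\mathcal A[\vartheta_1,\vartheta_2]=\{e^{i\theta}:\vartheta_1\le\theta\le\vartheta_2\}$. Let $\mu$ be a nontrivial probability Borel measure (that is, one with infinite support) on the unit circle $\mathbb T$, with monic orthogonal polynomials $\Phi_n$ and Verblunsky coefficients $\alpha_{n}=-\overline{\Phi_{n+1}(0)}$, $n\ge0$. Put $\tau_0=1$, $\tau_n=\dfrac{\tau_{n-1}-\overline{\alpha_{n-1}}}{1-\tau_{n-1}\alpha_{n-1}}$ and, for $n\ge1$, $$c_n=\frac{-\operatorname{Im}(\tau_{n-1}\alpha_{n-1})}{1-\operatorname{Re}(\tau_{n-1}\alpha_{n-1})},\qquad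 g_n=\frac12\,\frac{|1-\tau_{n-1}\alpha_{n-1}|^2}{1-\operatorname{Re}(\tau_{n-1}\alpha_{n-1})},\qquad d_{n+1}=(1-g_n)g_{n+1}.$$ With $a=\mu(\{1\})<1$, let $\mu(t;\cdot)=\frac{1-t}{1-a}\,\mu+\frac{t-a}{1-a}\,\delta_1$ for $0\le t<1$; in particular $\mu(0;\cdot)$ is the probability measure obtained from $\mu$ by removing the mass at $z=1$ and normalizing. Theorem. Let $\{c_n\}_{n\ge1}$ be a real sequence and $\{d_{n+1}\}_{n\ge1}$ a non SP positive chain sequence, and let $\mu(t;\cdot)$, $0\le t<1$, be the corresponding family of measures, that is, the family above for a nontrivial probability measure $\mu$ on $\mathbb T$ from which $\{c_n\}$ and $\{d_{n+1}\}$ arise by the formulas above. Let $\{q_{n+1}\}_{n\ge1}$ be a scaling sequence for $\{d_{n+1}\}$, let $q^{(1)}_1=q_2$ and $q^{(1)}_n=\max\{q_n,q_{n+1}\}$ for $n\ge2$, and for $n\ge1$ set $$u_{1,n}=\frac{c_n+\sqrt{c_n^2+(1-q_n^{(1)})}}{1+\sqrt{q_n^{(1)}}},\qquad v_{1,n}=\frac{1+\sqrt{q_n^{(1)}}}{-c_n+\sqrt{c_n^2+(1-q_n^{(1)})}},$$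 where $v_{1,n}=+\infty$ if its denominator is $0$ (that is, if $q^{(1)}_n=1$ and $c_n\ge0$). Then there are $0\le\vartheta_1<\vartheta_2\le2\pi$ (necessarily unique) with $$\cot(\vartheta_1/4)=\sup_{n\ge1}v_{1,n},\qquad \cot(\vartheta_2/4)=\inf_{n\ge1}u_{1,n}\qquad(\cot 0:=+\infty),$$ and $$\operatorname{supp}\mu(0;\cdot)\subseteq\mathcal A[\vartheta_1,\vartheta_2].$$ -/

import Mathlib

open MeasureTheory
open scoped ComplexConjugate Polynomial

noncomputable section

/-- The unit circle carries its Borel sigma-algebra. -/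
instance circleMeasurableSpace : MeasurableSpace Circle := borel Circle

instance circleBorelSpace : BorelSpace Circle := ⟨rfl⟩

/-- A nontrivial probability Borel measure on the unit circle: its support is infinite. -/
structure IsNontrivialProbability (μ : Measure Circle) : Prop where
  isProbability : IsProbabilityMeasure μ
  infinite_support : μ.support.Infinite

/-- `Φ 0, Φ 1, …` are the monic orthogonal polynomials on the unit circle for `μ`:
`Φ n` is monic of degree `n` and orthogonal in `L²(μ)` to `1, z, …, z ^ (n - 1)`. -/
structure IsMonicOPUC (μ : Measure Circle) (Φ : ℕ → ℂ[X]) : Prop where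
  monic : ∀ n, (Φ n).Monic
  natDegree_eq : ∀ n, (Φ n).natDegree = n
  orthogonal : ∀ n k, k < n → ∫ z : Circle, (Φ n).eval (z : ℂ) * conj ((z : ℂ) ^ k) ∂μ = 0

/-- The Verblunsky coefficients `α_n = - conj (Φ_{n+1}(0))`. -/
def verblunsky (Φ : ℕ → ℂ[X]) (n : ℕ) : ℂ := -conj ((Φ (n + 1)).eval 0)

/-- `τ_0 = 1`, `τ_{n+1} = (τ_n - conj α_n) / (1 - τ_n α_n)`. -/
def tauSeq (α : ℕ → ℂ) : ℕ → ℂ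
  | 0 => 1
  | n + 1 => (tauSeq α n - conj (α n)) / (1 - tauSeq α n * α n)

/-- `c_n = - Im (τ_{n-1} α_{n-1}) / (1 - Re (τ_{n-1} α_{n-1}))`, for `n ≥ 1`. -/
def cCoeff (α : ℕ → ℂ) (n : ℕ) : ℝ :=
  -(tauSeq α (n - 1) * α (n - 1)).im / (1 - (tauSeq α (n - 1) * α (n - 1)).re)

/-- `g_n = |1 - τ_{n-1} α_{n-1}|² / (2 (1 - Re (τ_{n-1} α_{n-1})))`, for `n ≥ 1`. -/
def gCoeff (α : ℕ → ℂ) (n : ℕ) : ℝ :=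
  (1 / 2) * (‖1 - tauSeq α (n - 1) * α (n - 1)‖ ^ 2 /
    (1 - (tauSeq α (n - 1) * α (n - 1)).re))

/-- The sequences `(c_n)_{n ≥ 1}` and `(d_{n+1})_{n ≥ 1}` are the ones computed from the Verblunsky
coefficients of `μ`, with `d_{n+1} = (1 - g_n) g_{n+1}`.
The values `c 0`, `d 0`, `d 1` play no role. -/
def HasCDParametrization (μ : Measure Circle) (c d : ℕ → ℝ) : Prop :=
  ∃ Φ : ℕ → ℂ[X], IsMonicOPUC μ Φ ∧ ∀ n, 1 ≤ n →
    c n = cCoeff (verblunsky Φ) n ∧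
    d (n + 1) = (1 - gCoeff (verblunsky Φ) n) * gCoeff (verblunsky Φ) (n + 1)

/-- With `a = μ {1} < 1`, the measure `μ(t; ·) = (1 - t)/(1 - a) μ + (t - a)/(1 - a) δ_1`.
It is written as a sum of two nonnegative terms: off `1` it is `(1 - t)/(1 - a) μ`, and the mass at
`1` is `(1 - t)/(1 - a) a + (t - a)/(1 - a) = t`. -/
def massFamily (μ : Measure Circle) (t : ℝ) : Measure Circle :=
  ENNReal.ofReal ((1 - t) / (1 - μ.real {1})) • μ.restrict {1}ᶜ +
    ENNReal.ofReal t • Measure.dirac (1 : Circle)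

/-- `(g_n)_{n ≥ 1}` is a parameter sequence for `(d_{n+1})_{n ≥ 1}`. -/
structure IsParameterSeq (d g : ℕ → ℝ) : Prop where
  first_nonneg : 0 ≤ g 1
  first_lt_one : g 1 < 1
  pos : ∀ n, 2 ≤ n → 0 < g n
  lt_one : ∀ n, 2 ≤ n → g n < 1
  eq_mul : ∀ n, 1 ≤ n → d (n + 1) = (1 - g n) * g (n + 1)

/-- `(d_{n+1})_{n ≥ 1}` is a positive chain sequence. -/
def IsPositiveChainSeq (d : ℕ → ℝ) : Prop := ∃ g, IsParameterSeq d g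

/-- `(d_{n+1})_{n ≥ 1}` is a non single parameter positive chain sequence:
it has more than one parameter sequence. -/
def IsNonSPChainSeq (d : ℕ → ℝ) : Prop :=
  ∃ g h : ℕ → ℝ, IsParameterSeq d g ∧ IsParameterSeq d h ∧ ∃ n, 1 ≤ n ∧ g n ≠ h n

/-- `(q_{n+1})_{n ≥ 1}` is a scaling sequence for the positive chain sequence
`(d_{n+1})_{n ≥ 1}`. -/
structure IsScalingSeq (d q : ℕ → ℝ) : Prop where
  pos : ∀ n, 1 ≤ n → 0 < q (n + 1)
  le_one : ∀ n, 1 ≤ n → q (n + 1) ≤ 1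
  chain : IsPositiveChainSeq (fun n => d n / q n)

/-- `q^{(1)}_1 = q_2` and `q^{(1)}_n = max (q_n, q_{n+1})` for `n ≥ 2`. -/
def qOne (q : ℕ → ℝ) (n : ℕ) : ℝ := if n = 1 then q 2 else max (q n) (q (n + 1))

/-- `u_{1,n} = (c_n + √(c_n² + (1 - q^{(1)}_n))) / (1 + √q^{(1)}_n)`. -/
def uOne (c q : ℕ → ℝ) (n : ℕ) : ℝ :=
  (c n + √(c n ^ 2 + (1 - qOne q n))) / (1 + √(qOne q n))

/-- `v_{1,n} = (1 + √q^{(1)}_n) / (-c_n + √(c_n² + (1 - q^{(1)}_n)))`, which is `+∞` when the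
denominator vanishes (that is, when `q^{(1)}_n = 1` and `c_n ≥ 0`). -/
def vOne (c q : ℕ → ℝ) (n : ℕ) : EReal :=
  if -c n + √(c n ^ 2 + (1 - qOne q n)) = 0 then ⊤
  else (((1 + √(qOne q n)) / (-c n + √(c n ^ 2 + (1 - qOne q n))) : ℝ) : EReal)

/-- The cotangent on `[0, π/2]`, with `cot 0 = +∞`. -/
def extCot (x : ℝ) : EReal := if x = 0 then ⊤ else (Real.cot x : EReal)

/-- The closed arc `{e^{iθ} : ϑ₁ ≤ θ ≤ ϑ₂}`. -/
def closedArc (ϑ₁ ϑ₂ : ℝ) : Set Circle := {z | ∃ θ : ℝ, ϑ₁ ≤ θ ∧ θ ≤ ϑ₂ ∧ z = Circle.exp θ}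

end

/-! On the circle, (z - 1)(z - e^{iθ})/z is a constant of modulus 2 times a real weight of constant
sign on each of the two open arcs between 1 and e^{iθ}. If the form with this weight degenerates on
polynomials of degree < n, then multiplying a degenerate vector by (z - 1)(z - e^{iθ}) gives a
multiple of the para-orthogonal polynomial zΦ_n - τ_nΦ_n^*, so that polynomial vanishes at e^{iθ}
(`IsMonicOPUC.chainPoly_eq_zero`). Apart from z - 1 and nonzero factors it is a real function
W_n(θ), with W_{n+2} = (cos(θ/2) - c_{n+2} sin(θ/2)) W_{n+1} - d_{n+2} W_n (`paraScale_mul_eq`).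

With l = cot(θ/2) the weight is, up to a positive factor, l(1 - Re z) - Im z, which is linear in l.
Its Gram matrices are positive for large l and can lose positivity only at a zero of some W_n. If no
W_n vanishes on (0, ϑ₁), the weight at ϑ₁ is therefore nonnegative on all |p|², hence μ-a.e., and μ
has no mass on the open arc from 1 to e^{iϑ₁} (`IsMonicOPUC.ae_cotWeight_nonneg`); the other end is
symmetric. The weight vanishes at 1, so nothing is learnt about a mass there, which is why μ(0;·)
appears.

W_n has no zero where every factor cos(θ/2) - c_n sin(θ/2) is ≥ √q_n^{(1)}, or every one is ≤
-√q_n^{(1)}: Wall's comparison with a parameter sequence of d/q (`IsScalingSeq.recurrence_pos`).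
Solving these inequalities for cot(θ/4) gives v_{1,n} and u_{1,n}. -/

noncomputable section

/-! ### Weighted sesquilinear forms on polynomials. -/

/-- The sesquilinear form `∫ p conj(q) w dμ` on polynomials, for a real continuous weight `w`. -/
def polyForm (μ : Measure Circle) (w : C(Circle, ℝ)) (p q : ℂ[X]) : ℂ :=
  ∫ z : Circle, p.eval (z : ℂ) * conj (q.eval (z : ℂ)) * (w z : ℂ) ∂μ

lemma continuous_eval_circle (p : ℂ[X]) : Continuous fun z : Circle => p.eval (z : ℂ) :=
  p.continuous.comp continuous_subtype_val

lemma integrable_circle {E : Type*} [NormedAddCommGroup E] {μ : Measure Circle} [IsFiniteMeasure μ]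
    [SecondCountableTopology E] {f : Circle → E} (hf : Continuous f) :
    Integrable f μ :=
  hf.integrable_of_hasCompactSupport (HasCompactSupport.of_compactSpace f)

lemma continuous_polyForm_integrand (w : C(Circle, ℝ)) (p q : ℂ[X]) :
    Continuous fun z : Circle => p.eval (z : ℂ) * conj (q.eval (z : ℂ)) * (w z : ℂ) :=
  ((continuous_eval_circle p).mul
    (Complex.continuous_conj.comp (continuous_eval_circle q))).mul
    (Complex.continuous_ofReal.comp w.continuous)

section Form

variable {μ : Measure Circle} (w : C(Circle, ℝ))

lemma polyForm_add_left [IsFiniteMeasure μ] (p p' q : ℂ[X]) :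
    polyForm μ w (p + p') q = polyForm μ w p q + polyForm μ w p' q := by
  unfold polyForm
  rw [← integral_add (integrable_circle (continuous_polyForm_integrand w p q))
    (integrable_circle (continuous_polyForm_integrand w p' q))]
  congr 1; ext z; simp only [Polynomial.eval_add]; ring

lemma polyForm_C_mul_left (a : ℂ) (p q : ℂ[X]) :
    polyForm μ w (Polynomial.C a * p) q = a * polyForm μ w p q := by
  unfold polyForm
  rw [← integral_const_mul]
  congr 1; ext z; simp only [Polynomial.eval_mul, Polynomial.eval_C]; ring

lemma polyForm_conj_symm (p q : ℂ[X]) : conj (polyForm μ w p q) = polyForm μ w q p := by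
  unfold polyForm
  rw [← integral_conj]
  congr 1; ext z; simp only [map_mul, Complex.conj_conj, Complex.conj_ofReal]; ring

lemma polyForm_add_right [IsFiniteMeasure μ] (p q q' : ℂ[X]) :
    polyForm μ w p (q + q') = polyForm μ w p q + polyForm μ w p q' := by
  rw [← polyForm_conj_symm, polyForm_add_left, map_add, polyForm_conj_symm, polyForm_conj_symm]

lemma polyForm_C_mul_right (a : ℂ) (p q : ℂ[X]) :
    polyForm μ w p (Polynomial.C a * q) = conj a * polyForm μ w p q := by
  rw [← polyForm_conj_symm, polyForm_C_mul_left, map_mul, polyForm_conj_symm]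

lemma polyForm_sub_left [IsFiniteMeasure μ] (p p' q : ℂ[X]) :
    polyForm μ w (p - p') q = polyForm μ w p q - polyForm μ w p' q := by
  have := polyForm_add_left (μ := μ) w (p - p') p' q
  rw [sub_add_cancel] at this
  rw [this]; ring

@[simp] lemma polyForm_zero_left (q : ℂ[X]) : polyForm μ w 0 q = 0 := by
  simp [polyForm]

@[simp] lemma polyForm_zero_right (q : ℂ[X]) : polyForm μ w q 0 = 0 := by
  simp [polyForm]

lemma polyForm_sum_left [IsFiniteMeasure μ] {ι : Type*} (s : Finset ι) (f : ι → ℂ[X]) (q : ℂ[X]) :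
    polyForm μ w (∑ i ∈ s, f i) q = ∑ i ∈ s, polyForm μ w (f i) q := by
  classical
  induction s using Finset.induction_on with
  | empty => simp
  | insert a s ha ih => rw [Finset.sum_insert ha, Finset.sum_insert ha, polyForm_add_left, ih]

lemma polyForm_sum_right [IsFiniteMeasure μ] {ι : Type*} (s : Finset ι) (f : ι → ℂ[X]) (q : ℂ[X]) :
    polyForm μ w q (∑ i ∈ s, f i) = ∑ i ∈ s, polyForm μ w q (f i) := by
  rw [← polyForm_conj_symm, polyForm_sum_left, map_sum]
  simp only [polyForm_conj_symm]

lemma polyForm_X_mul_X_mul (p q : ℂ[X]) :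
    polyForm μ w (Polynomial.X * p) (Polynomial.X * q) = polyForm μ w p q := by
  unfold polyForm
  congr 1; ext z
  have hz : (z : ℂ) * conj (z : ℂ) = 1 := by
    rw [Complex.mul_conj, Circle.normSq_coe]; simp
  simp only [Polynomial.eval_mul, Polynomial.eval_X, map_mul]
  linear_combination (Polynomial.eval (z : ℂ) p * conj (Polynomial.eval (z : ℂ) q) * (w z : ℂ)) * hz

lemma polyForm_self (p : ℂ[X]) :
    polyForm μ w p p = ((∫ z : Circle, ‖p.eval (z : ℂ)‖ ^ 2 * w z ∂μ : ℝ) : ℂ) := by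
  unfold polyForm
  rw [← integral_complex_ofReal]
  congr 1; ext z
  rw [Complex.mul_conj, Complex.normSq_eq_norm_sq]; push_cast; ring

/-- Orthogonality to monomials of degree in `[0, n)` gives orthogonality to polynomials. -/
lemma polyForm_eq_zero_of_degree_lt [IsFiniteMeasure μ] {p q : ℂ[X]} {n : ℕ}
    (h : ∀ k < n, polyForm μ w p (Polynomial.X ^ k) = 0) (hq : q.degree < n) :
    polyForm μ w p q = 0 := by
  rcases eq_or_ne q 0 with rfl | h0
  · exact polyForm_zero_right w p
  rw [Polynomial.as_sum_range_C_mul_X_pow' q ((Polynomial.natDegree_lt_iff_degree_lt h0).2 hq),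
    polyForm_sum_right]
  refine Finset.sum_eq_zero fun k hk => ?_
  rw [polyForm_C_mul_right, h k (Finset.mem_range.1 hk), mul_zero]

end Form

/-- A nonnegative continuous function with zero integral vanishes on the support. -/
lemma eq_zero_on_support {μ : Measure Circle} [IsFiniteMeasure μ] {f : Circle → ℝ}
    (hf : Continuous f) (h0 : ∀ z, 0 ≤ f z) (hI : ∫ z, f z ∂μ = 0) :
    ∀ z ∈ μ.support, f z = 0 := by
  have hae := (integral_eq_zero_iff_of_nonneg h0 (integrable_circle hf)).1 hI
  intro z hz
  have hcl : IsClosed {z | f z = 0} := isClosed_eq hf continuous_const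
  exact Measure.support_subset_of_isClosed hcl hae hz

/-- The quadratic form is definite when the weight is nonnegative and has finitely many zeros. -/
lemma eq_zero_of_polyForm_self {μ : Measure Circle} (hμ : IsNontrivialProbability μ)
    {w : C(Circle, ℝ)} (hw : ∀ z, 0 ≤ w z) (hfin : {z | w z = 0}.Finite) {p : ℂ[X]}
    (h : polyForm μ w p p = 0) : p = 0 := by
  have := hμ.isProbability
  rw [polyForm_self, Complex.ofReal_eq_zero] at h
  have h1 := eq_zero_on_support (μ := μ)
    (((continuous_eval_circle p).norm.pow 2).mul w.continuous)
    (fun z => mul_nonneg (sq_nonneg _) (hw z)) h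
  by_contra hp
  have hroots : {z : Circle | p.eval (z : ℂ) = 0}.Finite := by
    have := p.finite_setOfPred_isRoot hp
    exact this.preimage (f := fun z : Circle => (z : ℂ)) Subtype.val_injective.injOn
  refine hμ.infinite_support ((hroots.union hfin).subset fun z hz => ?_)
  rcases mul_eq_zero.1 (h1 z hz) with h2 | h2
  · exact Or.inl (norm_eq_zero.1 (pow_eq_zero_iff two_ne_zero |>.1 h2))
  · exact Or.inr h2

/-! ### Reversed polynomials, the Szegő recurrence, and |α_n| < 1. -/

lemma Circle.coe_mul_conj (z : Circle) : (z : ℂ) * conj (z : ℂ) = 1 := by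
  rw [Complex.mul_conj, Circle.normSq_coe]; simp

/-- The reversed polynomial `p^*(z) = z ^ n * conj (p (1 / conj z))`. -/
def revStar (n : ℕ) (p : ℂ[X]) : ℂ[X] := (p.map (starRingEnd ℂ)).reflect n

lemma natDegree_revStar_le {n : ℕ} {p : ℂ[X]} (hp : p.natDegree ≤ n) :
    (revStar n p).natDegree ≤ n := by
  refine Polynomial.natDegree_reflect_le.trans ?_
  rw [Polynomial.natDegree_map]
  exact max_le le_rfl hp

lemma revStar_eval {n : ℕ} {p : ℂ[X]} (hp : p.natDegree ≤ n) (z : Circle) :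
    (revStar n p).eval (z : ℂ) = (z : ℂ) ^ n * conj (p.eval (z : ℂ)) := by
  have hz := Circle.coe_mul_conj z
  let _ : Invertible (conj (z : ℂ)) := ⟨(z : ℂ), hz, by rw [mul_comm]; exact hz⟩
  have h := Polynomial.eval₂_reflect_mul_pow (RingHom.id ℂ) (conj (z : ℂ)) n
    (p.map (starRingEnd ℂ)) (by rwa [Polynomial.natDegree_map])
  have hinv : ⅟(conj (z : ℂ)) = (z : ℂ) := rfl
  rw [hinv, Polynomial.eval₂_id, Polynomial.eval₂_id, Polynomial.eval_map,
    Polynomial.eval₂_at_apply] at h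
  rw [← h, revStar]
  have : (z : ℂ) ^ n * conj (z : ℂ) ^ n = 1 := by rw [← mul_pow, hz, one_pow]
  linear_combination -(Polynomial.eval (z : ℂ) (Polynomial.reflect n (p.map (starRingEnd ℂ)))) * this

lemma revStar_eval_zero {n : ℕ} {p : ℂ[X]} (hp : p.Monic) (hn : p.natDegree = n) :
    (revStar n p).eval 0 = 1 := by
  rw [← Polynomial.coeff_zero_eq_eval_zero, revStar, Polynomial.coeff_reflect,
    Polynomial.revAt_zero, Polynomial.coeff_map, ← hn, hp.coeff_natDegree, map_one]

section OPUC

variable {μ : Measure Circle} {Φ : ℕ → ℂ[X]}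

lemma IsMonicOPUC.polyForm_eq_zero (hΦ : IsMonicOPUC μ Φ) {n k : ℕ} (hk : k < n) :
    polyForm μ 1 (Φ n) (Polynomial.X ^ k) = 0 := by
  have := hΦ.orthogonal n k hk
  rw [← this, polyForm]
  congr 1; ext z; simp

lemma polyForm_one_self_eq_zero (hμ : IsNontrivialProbability μ) {p : ℂ[X]}
    (h : polyForm μ 1 p p = 0) : p = 0 :=
  eq_zero_of_polyForm_self hμ (w := 1) (fun z => by simp) (by simp) h

/-- On the circle Φ_n^* = z^n conj Φ_n, so this pairing is conjugate to that of Φ_n with z^{n-1-k}.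
-/
lemma IsMonicOPUC.polyForm_revStar (hΦ : IsMonicOPUC μ Φ) {n k : ℕ} (hk : k < n) :
    polyForm μ 1 (revStar n (Φ n)) (Polynomial.X ^ (k + 1)) = 0 := by
  have h := hΦ.polyForm_eq_zero (n := n) (k := n - 1 - k) (by omega)
  rw [← polyForm_conj_symm, map_eq_zero]
  rw [← h, polyForm, polyForm]
  congr 1; ext z
  rw [revStar_eval (hΦ.natDegree_eq n).le]
  have hz := Circle.coe_mul_conj z
  simp only [Polynomial.eval_pow, Polynomial.eval_X, map_mul, map_pow, Complex.conj_conj]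
  have : (z : ℂ) ^ (k + 1) * conj (z : ℂ) ^ n = conj (z : ℂ) ^ (n - 1 - k) := by
    have h1 : ((z : ℂ) * conj (z : ℂ)) ^ (k + 1) = 1 := by rw [hz, one_pow]
    have h2 : conj (z : ℂ) ^ n = conj (z : ℂ) ^ (k + 1) * conj (z : ℂ) ^ (n - 1 - k) := by
      rw [← pow_add]; congr 1; omega
    rw [h2, ← mul_assoc, ← mul_pow, h1, one_mul]
  rw [← this]; ring

/-- A polynomial of degree at most `n` orthogonal to `z, …, z ^ n` is a multiple of `Φ_n^*`. -/
lemma IsMonicOPUC.eq_C_mul_revStar (hμ : IsNontrivialProbability μ) (hΦ : IsMonicOPUC μ Φ)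
    {n : ℕ} {f : ℂ[X]} (hf : f.natDegree ≤ n)
    (h : ∀ k < n, polyForm μ 1 f (Polynomial.X ^ (k + 1)) = 0) :
    f = Polynomial.C (f.eval 0) * revStar n (Φ n) := by
  have := hμ.isProbability
  rw [← sub_eq_zero]
  set g := f - Polynomial.C (f.eval 0) * revStar n (Φ n) with hg
  have hg0 : g.eval 0 = 0 := by
    simp [hg, revStar_eval_zero (hΦ.monic n) (hΦ.natDegree_eq n)]
  have hdeg : g.natDegree ≤ n := by
    refine (Polynomial.natDegree_sub_le _ _).trans (max_le hf ?_)
    exact (Polynomial.natDegree_C_mul_le _ _).trans (natDegree_revStar_le (hΦ.natDegree_eq n).le)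
  have hort : ∀ k < n, polyForm μ 1 g (Polynomial.X ^ (k + 1)) = 0 := fun k hk => by
    rw [hg, polyForm_sub_left, polyForm_C_mul_left, h k hk, hΦ.polyForm_revStar hk]; simp
  apply polyForm_one_self_eq_zero hμ
  have hsum := Polynomial.as_sum_range_C_mul_X_pow' g (Nat.lt_succ_of_le hdeg)
  rw [show polyForm μ 1 g g = polyForm μ 1 g _ from congrArg (polyForm μ 1 g) hsum,
    polyForm_sum_right]
  refine Finset.sum_eq_zero fun k hk => ?_
  rw [polyForm_C_mul_right]
  rcases k with _ | k
  · rw [Polynomial.coeff_zero_eq_eval_zero, hg0]; simp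
  · rw [hort k (by have := Finset.mem_range.1 hk; omega), mul_zero]

lemma IsMonicOPUC.polyForm_X_mul (hΦ : IsMonicOPUC μ Φ) {n k : ℕ} (hk : k < n) :
    polyForm μ 1 (Polynomial.X * Φ n) (Polynomial.X ^ (k + 1)) = 0 := by
  rw [pow_succ', polyForm_X_mul_X_mul, hΦ.polyForm_eq_zero hk]

lemma IsMonicOPUC.natDegree_X_mul (hΦ : IsMonicOPUC μ Φ) (n : ℕ) :
    (Polynomial.X * Φ n).natDegree = n + 1 := by
  rw [Polynomial.natDegree_X_mul (hΦ.monic n).ne_zero, hΦ.natDegree_eq]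

lemma natDegree_le_of_sub {p q : ℂ[X]} {n : ℕ} (hp : p.natDegree ≤ n + 1)
    (hq : q.natDegree ≤ n + 1) (h : p.coeff (n + 1) = q.coeff (n + 1)) :
    (p - q).natDegree ≤ n := by
  rw [Polynomial.natDegree_le_iff_coeff_eq_zero]
  intro N hN
  rw [Polynomial.coeff_sub]
  rcases eq_or_lt_of_le (Nat.succ_le_of_lt hN) with rfl | h2
  · rw [Nat.succ_eq_add_one, h, sub_self]
  · rw [Polynomial.coeff_eq_zero_of_natDegree_lt (by omega),
      Polynomial.coeff_eq_zero_of_natDegree_lt (by omega), sub_zero]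

/-- The Szegő recurrence. -/
lemma IsMonicOPUC.szego (hμ : IsNontrivialProbability μ) (hΦ : IsMonicOPUC μ Φ) (n : ℕ) :
    Φ (n + 1) = Polynomial.X * Φ n -
      Polynomial.C (conj (verblunsky Φ n)) * revStar n (Φ n) := by
  have := hμ.isProbability
  have h := hΦ.eq_C_mul_revStar hμ (n := n) (f := Polynomial.X * Φ n - Φ (n + 1))
    (natDegree_le_of_sub (hΦ.natDegree_X_mul n).le (hΦ.natDegree_eq (n + 1)).le (by
      rw [Polynomial.coeff_X_mul]
      have h1 := (hΦ.monic n).coeff_natDegree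
      have h2 := (hΦ.monic (n + 1)).coeff_natDegree
      rw [hΦ.natDegree_eq] at h1 h2
      rw [h1, h2]))
    (fun k hk => by
      rw [polyForm_sub_left, hΦ.polyForm_X_mul hk, hΦ.polyForm_eq_zero (by omega), sub_zero])
  have h0 : (Polynomial.X * Φ n - Φ (n + 1)).eval 0 = conj (verblunsky Φ n) := by
    simp [verblunsky]
  rw [h0] at h
  rw [← h]; ring

/-- Verblunsky coefficients lie in the open unit disc. -/
lemma IsMonicOPUC.norm_verblunsky_lt_one (hμ : IsNontrivialProbability μ) (hΦ : IsMonicOPUC μ Φ)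
    (n : ℕ) : ‖verblunsky Φ n‖ < 1 := by
  have := hμ.isProbability
  set α := verblunsky Φ n
  set S := revStar n (Φ n)
  have hpos : ∀ p : ℂ[X], p ≠ 0 → 0 < ∫ z : Circle, ‖p.eval (z : ℂ)‖ ^ 2 ∂μ := fun p hp => by
    refine lt_of_le_of_ne (integral_nonneg fun z => sq_nonneg _) fun h => hp ?_
    apply polyForm_one_self_eq_zero hμ
    rw [polyForm_self]
    simp [← h]
  have hreal : ∀ p : ℂ[X], polyForm μ 1 p p =
      ((∫ z : Circle, ‖p.eval (z : ℂ)‖ ^ 2 ∂μ : ℝ) : ℂ) := fun p => by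
    rw [polyForm_self]; simp
  have hS : polyForm μ 1 S S = polyForm μ 1 (Φ n) (Φ n) := by
    rw [hreal, hreal]
    congr 2; ext z
    rw [revStar_eval (hΦ.natDegree_eq n).le, norm_mul, norm_pow, Circle.norm_coe, one_pow, one_mul,
      Complex.norm_conj]
  have hort : polyForm μ 1 (Φ (n + 1)) S = 0 := by
    refine polyForm_eq_zero_of_degree_lt 1 (n := n + 1) (fun k hk => hΦ.polyForm_eq_zero hk) ?_
    refine Polynomial.degree_le_natDegree.trans_lt ?_
    exact_mod_cast Nat.lt_succ_of_le (natDegree_revStar_le (hΦ.natDegree_eq n).le)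
  have hort' : polyForm μ 1 S (Φ (n + 1)) = 0 := by
    rw [← polyForm_conj_symm, hort, map_zero]
  have hX : Polynomial.X * Φ n = Φ (n + 1) + Polynomial.C (conj α) * S := by
    rw [hΦ.szego hμ n]; ring
  -- Pythagoras for zΦ_n = Φ_{n+1} + conj(α) Φ_n^*, which gives ‖Φ_{n+1}‖² = (1 - |α|²)‖Φ_n‖².
  have key : polyForm μ 1 (Φ n) (Φ n) = polyForm μ 1 (Φ (n + 1)) (Φ (n + 1)) +
      (conj α * α) * polyForm μ 1 (Φ n) (Φ n) := by
    conv_lhs => rw [← polyForm_X_mul_X_mul, hX]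
    simp only [polyForm_add_left, polyForm_add_right, polyForm_C_mul_left, polyForm_C_mul_right,
      hort, hort', hS, Complex.conj_conj]
    ring
  rw [hreal, hreal, mul_comm (conj α), Complex.mul_conj, Complex.normSq_eq_norm_sq] at key
  norm_cast at key
  have h1 := hpos _ (hΦ.monic n).ne_zero
  have h2 := hpos _ (hΦ.monic (n + 1)).ne_zero
  by_contra hcon
  push Not at hcon
  nlinarith [mul_le_mul hcon hcon zero_le_one (norm_nonneg α)]

end OPUC

/-! ### The unimodular numbers τ_n and the para-orthogonal polynomials. -/

/-- For |τ| = 1 the numerator is τ times the conjugate of the denominator. -/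
lemma tauSeq_step {τ α : ℂ} (hτ : ‖τ‖ = 1) (hα : ‖α‖ < 1) :
    1 - τ * α ≠ 0 ∧ ‖(τ - conj α) / (1 - τ * α)‖ = 1 := by
  have h1 : 1 - τ * α ≠ 0 := fun h => by
    have : ‖τ * α‖ = 1 := by rw [← sub_eq_zero.1 h, norm_one]
    rw [norm_mul, hτ, one_mul] at this
    linarith
  refine ⟨h1, ?_⟩
  have hτ2 : τ * conj τ = 1 := by
    rw [Complex.mul_conj, Complex.normSq_eq_norm_sq, hτ]; simp
  have h2 : τ - conj α = τ * conj (1 - τ * α) := by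
    simp only [map_sub, map_one, map_mul]
    linear_combination (conj α) * hτ2
  rw [norm_div, h2, norm_mul, Complex.norm_conj, hτ, one_mul, div_self (norm_ne_zero_iff.2 h1)]

lemma norm_tauSeq {α : ℕ → ℂ} (hα : ∀ n, ‖α n‖ < 1) (n : ℕ) : ‖tauSeq α n‖ = 1 := by
  induction n with
  | zero => simp [tauSeq]
  | succ n ih => exact (tauSeq_step ih (hα n)).2

lemma one_sub_tauSeq_mul_ne_zero {α : ℕ → ℂ} (hα : ∀ n, ‖α n‖ < 1) (n : ℕ) :
    1 - tauSeq α n * α n ≠ 0 := (tauSeq_step (norm_tauSeq hα n) (hα n)).1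

section OPUC

variable {μ : Measure Circle} {Φ : ℕ → ℂ[X]}

lemma IsMonicOPUC.szego_eval (hμ : IsNontrivialProbability μ) (hΦ : IsMonicOPUC μ Φ) (n : ℕ)
    (z : Circle) : (Φ (n + 1)).eval (z : ℂ) = z * (Φ n).eval (z : ℂ) -
      conj (verblunsky Φ n) * (revStar n (Φ n)).eval (z : ℂ) := by
  rw [hΦ.szego hμ n]; simp

lemma IsMonicOPUC.szego_revStar_eval (hμ : IsNontrivialProbability μ) (hΦ : IsMonicOPUC μ Φ)
    (n : ℕ) (z : Circle) : (revStar (n + 1) (Φ (n + 1))).eval (z : ℂ) =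
      (revStar n (Φ n)).eval (z : ℂ) - verblunsky Φ n * (z * (Φ n).eval (z : ℂ)) := by
  rw [revStar_eval (hΦ.natDegree_eq _).le, hΦ.szego_eval hμ, revStar_eval (hΦ.natDegree_eq _).le]
  simp only [map_sub, map_mul, Complex.conj_conj, map_pow]
  have hz := Circle.coe_mul_conj z
  have hzn : (z : ℂ) ^ n * conj (z : ℂ) ^ n = 1 := by rw [← mul_pow, hz, one_pow]
  rw [pow_succ]
  linear_combination (z : ℂ) ^ n * conj ((Φ n).eval (z : ℂ)) * hz
    - verblunsky Φ n * (z * (Φ n).eval (z : ℂ)) * hzn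

lemma IsMonicOPUC.eval_zero_index (hΦ : IsMonicOPUC μ Φ) : Φ 0 = 1 :=
  (hΦ.monic 0).natDegree_eq_zero.1 (hΦ.natDegree_eq 0)

/-- This identifies τ_n as Φ_n(1)/Φ_n^*(1), so zΦ_n - τ_nΦ_n^* vanishes at 1. -/
lemma IsMonicOPUC.eval_one (hμ : IsNontrivialProbability μ) (hΦ : IsMonicOPUC μ Φ) (n : ℕ) :
    (Φ n).eval 1 = tauSeq (verblunsky Φ) n * (revStar n (Φ n)).eval 1 ∧
      (revStar n (Φ n)).eval 1 ≠ 0 := by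
  induction n with
  | zero =>
    have h := revStar_eval (hΦ.natDegree_eq 0).le 1
    rw [hΦ.eval_zero_index] at h ⊢
    simp only [Circle.coe_one] at h
    rw [h]; simp [tauSeq]
  | succ n ih =>
    obtain ⟨h1, h2⟩ := ih
    have hs := hΦ.szego_eval hμ n 1
    have hr := hΦ.szego_revStar_eval hμ n 1
    have hne := one_sub_tauSeq_mul_ne_zero (hΦ.norm_verblunsky_lt_one hμ) n
    simp only [Circle.coe_one, one_mul] at hs hr
    rw [h1] at hs hr
    have hr' : (revStar (n + 1) (Φ (n + 1))).eval 1 =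
        (1 - tauSeq (verblunsky Φ) n * verblunsky Φ n) * (revStar n (Φ n)).eval 1 := by
      rw [hr]; ring
    refine ⟨?_, hr' ▸ mul_ne_zero hne h2⟩
    rw [hr', hs, tauSeq]
    field_simp

/-- The para-orthogonal polynomial `z Φ_n - τ_n Φ_n^*`, characterized by orthogonality. -/
lemma IsMonicOPUC.eq_C_mul_paraOrthogonal (hμ : IsNontrivialProbability μ)
    (hΦ : IsMonicOPUC μ Φ) {n : ℕ} {Q : ℂ[X]} (hQ : Q.natDegree ≤ n + 1) (hQ1 : Q.eval 1 = 0)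
    (h : ∀ k < n, polyForm μ 1 Q (Polynomial.X ^ (k + 1)) = 0) :
    Q = Polynomial.C (Q.coeff (n + 1)) * (Polynomial.X * Φ n -
      Polynomial.C (tauSeq (verblunsky Φ) n) * revStar n (Φ n)) := by
  have := hμ.isProbability
  set a := Q.coeff (n + 1)
  have h1 := hΦ.eq_C_mul_revStar hμ (n := n) (f := Q - Polynomial.C a * (Polynomial.X * Φ n))
    (natDegree_le_of_sub hQ
      ((Polynomial.natDegree_C_mul_le _ _).trans (hΦ.natDegree_X_mul n).le) (by
      have h1 := (hΦ.monic n).coeff_natDegree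
      rw [hΦ.natDegree_eq] at h1
      rw [Polynomial.coeff_C_mul, Polynomial.coeff_X_mul, h1, mul_one]))
    (fun k hk => by
      rw [polyForm_sub_left, polyForm_C_mul_left, hΦ.polyForm_X_mul hk, h k hk]; simp)
  set b := (Q - Polynomial.C a * (Polynomial.X * Φ n)).eval 0
  obtain ⟨hτ, hne⟩ := hΦ.eval_one hμ n
  have h2 := congrArg (Polynomial.eval 1) h1
  simp only [Polynomial.eval_sub, Polynomial.eval_mul, Polynomial.eval_C, Polynomial.eval_X,
    hQ1, hτ] at h2
  have hb : b = -(a * tauSeq (verblunsky Φ) n) := by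
    apply mul_right_cancel₀ hne
    linear_combination -h2
  rw [hb] at h1
  simp only [map_neg, map_mul] at h1
  linear_combination h1

end OPUC

/-! ### The real three-term recurrence for W_n. -/

/-- The real factor `cos (θ / 2) - c_n sin (θ / 2)`. -/
def chainFactor (c : ℕ → ℝ) (θ : ℝ) (n : ℕ) : ℝ := Real.cos (θ / 2) - c n * Real.sin (θ / 2)

/-- The real form `W_n(θ)` of the para-orthogonal polynomials on the unit circle. -/
def chainPoly (c d : ℕ → ℝ) (θ : ℝ) : ℕ → ℝ
  | 0 => 1
  | 1 => chainFactor c θ 1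
  | n + 2 => chainFactor c θ (n + 2) * chainPoly c d θ (n + 1) - d (n + 2) * chainPoly c d θ n

lemma Circle.exp_eq_sq_half (θ : ℝ) :
    ((Circle.exp θ : Circle) : ℂ) = (Circle.exp (θ / 2) : ℂ) ^ 2 := by
  have : Circle.exp θ = Circle.exp (θ / 2) * Circle.exp (θ / 2) := by
    rw [← Circle.exp_add]; congr 1; ring
  rw [this, Circle.coe_mul, sq]

lemma Circle.coe_exp_eq (θ : ℝ) :
    (Circle.exp θ : ℂ) = (Real.cos θ : ℂ) + (Real.sin θ : ℂ) * Complex.I := by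
  rw [Circle.coe_exp, Complex.exp_mul_I, Complex.ofReal_cos, Complex.ofReal_sin]

lemma cos_sq_add_sin_sq_coe (θ : ℝ) : (Real.cos θ : ℂ) ^ 2 + (Real.sin θ : ℂ) ^ 2 = 1 := by
  exact_mod_cast Real.cos_sq_add_sin_sq θ

lemma chainFactor_eq (c : ℕ → ℝ) (θ : ℝ) (n : ℕ) :
    (1 + c n * Complex.I) * (Circle.exp θ : ℂ) + (1 - c n * Complex.I) =
      2 * (Circle.exp (θ / 2) : ℂ) * chainFactor c θ n := by
  rw [Circle.exp_eq_sq_half, Circle.coe_exp_eq, chainFactor]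
  have h := cos_sq_add_sin_sq_coe (θ / 2)
  have hI := Complex.I_sq
  push_cast at h ⊢
  linear_combination (-(1 : ℂ) + c n * Complex.I) * h +
    (Complex.sin (θ / 2) ^ 2 * (1 + c n * Complex.I) + 2 * c n * Complex.cos (θ / 2)
      * Complex.sin (θ / 2)) * hI

section Recurrence

variable {α : ℕ → ℂ} {z : ℂ} {φ ψ : ℕ → ℂ}

/-- Three-term recurrence for `z φ_n - τ_n ψ_n`. -/
lemma paraOrthogonal_recurrence (hα : ∀ n, ‖α n‖ < 1)
    (hφ : ∀ n, φ (n + 1) = z * φ n - conj (α n) * ψ n)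
    (hψ : ∀ n, ψ (n + 1) = ψ n - α n * (z * φ n)) (n : ℕ) :
    (1 - tauSeq α n * α n) * ((1 - tauSeq α (n + 1) * α (n + 1)) *
        (z * φ (n + 2) - tauSeq α (n + 2) * ψ (n + 2))) =
      (1 - tauSeq α n * α n) * (((1 - tauSeq α (n + 1) * α (n + 1)) * z +
        (1 - conj (tauSeq α (n + 1) * α (n + 1)))) *
          (z * φ (n + 1) - tauSeq α (n + 1) * ψ (n + 1))) -
      (1 - tauSeq α (n + 1) * α (n + 1)) * (1 - conj (tauSeq α (n + 1) * α (n + 1))) *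
        (1 - tauSeq α n * α n * conj (tauSeq α n * α n)) * z *
          (z * φ n - tauSeq α n * ψ n) := by
  have unit : ∀ n, tauSeq α n * conj (tauSeq α n) = 1 := fun n => by
    rw [Complex.mul_conj, Complex.normSq_eq_norm_sq, norm_tauSeq hα]; simp
  -- In the variables X = zφ_n and Y = τ_nψ_n the Szegő step involves only z and β_n = τ_nα_n; X and
  -- Y are then eliminated linearly.
  have step : ∀ n, (1 - tauSeq α n * α n) * (tauSeq α (n + 1) * ψ (n + 1)) =
      (1 - conj (tauSeq α n * α n)) *
        (tauSeq α n * ψ n - (tauSeq α n * α n) * (z * φ n)) := fun n => by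
    have h1 := one_sub_tauSeq_mul_ne_zero hα n
    have h2 := unit n
    rw [hψ, tauSeq, map_mul]
    field_simp
    linear_combination (ψ n - α n * (z * φ n)) * conj (α n) * h2
  have stepX : ∀ n, z * φ (n + 1) = z * (z * φ n - conj (tauSeq α n * α n) *
      (tauSeq α n * ψ n)) := fun n => by
    rw [hφ, map_mul]
    linear_combination z * conj (α n) * ψ n * unit n
  have e1 := step n
  have e2 := step (n + 1)
  rw [stepX (n + 1)]
  have e3 := stepX n
  set X := z * φ n
  set Y := tauSeq α n * ψ n
  set X' := z * φ (n + 1)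
  set Y' := tauSeq α (n + 1) * ψ (n + 1)
  set Y'' := tauSeq α (n + 2) * ψ (n + 2)
  set β := tauSeq α n * α n
  set β' := tauSeq α (n + 1) * α (n + 1)
  linear_combination -(1 - β) * e2 + (1 - β') * z * (1 - conj β') * e1 -
    (1 - β) * (1 - β') * (1 - conj β') * e3

end Recurrence

section Normalized

variable {α : ℕ → ℂ}

lemma one_sub_re_pos (hα : ∀ n, ‖α n‖ < 1) (n : ℕ) : 0 < 1 - (tauSeq α n * α n).re := by
  have h : ‖tauSeq α n * α n‖ < 1 := by rw [norm_mul, norm_tauSeq hα, one_mul]; exact hα n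
  linarith [Complex.re_le_norm (tauSeq α n * α n)]

/-- The normalizing factors relating `z Φ_n - τ_n Φ_n^*` to `W_n`. -/
def paraScale (α : ℕ → ℂ) : ℕ → ℂ
  | 0 => 1
  | n + 1 => paraScale α n *
      ((1 - tauSeq α n * α n) / ((1 - (tauSeq α n * α n).re : ℝ) : ℂ))

lemma one_sub_add_I (hα : ∀ n, ‖α n‖ < 1) (n : ℕ) :
    (1 - tauSeq α n * α n) / ((1 - (tauSeq α n * α n).re : ℝ) : ℂ) =
      1 + cCoeff α (n + 1) * Complex.I ∧
    (1 - conj (tauSeq α n * α n)) / ((1 - (tauSeq α n * α n).re : ℝ) : ℂ) =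
      1 - cCoeff α (n + 1) * Complex.I := by
  have h := one_sub_re_pos hα n
  have hne : ((1 - (tauSeq α n * α n).re : ℝ) : ℂ) ≠ 0 := by exact_mod_cast h.ne'
  have hc : (cCoeff α (n + 1) : ℂ) * ((1 - (tauSeq α n * α n).re : ℝ) : ℂ) =
      -((tauSeq α n * α n).im : ℂ) := by
    rw [cCoeff, Nat.add_sub_cancel]
    rw [← Complex.ofReal_mul, div_mul_cancel₀ _ h.ne', Complex.ofReal_neg]
  set β := tauSeq α n * α n
  have hβ : β = (β.re : ℂ) + (β.im : ℂ) * Complex.I := (Complex.re_add_im β).symm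
  have hβ' : conj β = (β.re : ℂ) - (β.im : ℂ) * Complex.I := by
    apply Complex.ext <;> simp
  constructor
  · rw [div_eq_iff hne]
    push_cast at hc ⊢
    linear_combination -hβ - Complex.I * hc
  · rw [div_eq_iff hne]
    push_cast at hc ⊢
    linear_combination -hβ' + Complex.I * hc

/-- With `gCoeff_mul`, this converts the coefficient |1 - β_{n+1}|²(1 - |β_n|²) of the unnormalized
recurrence into d_{n+2} times 4(1 - Re β_n)(1 - Re β_{n+1}), where β_n = τ_nα_n. -/
lemma one_sub_gCoeff (hα : ∀ n, ‖α n‖ < 1) (n : ℕ) :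
    (1 - gCoeff α (n + 1)) * (2 * (1 - (tauSeq α n * α n).re)) =
      1 - ‖tauSeq α n * α n‖ ^ 2 := by
  have h := one_sub_re_pos hα n
  rw [gCoeff, Nat.add_sub_cancel]
  set β := tauSeq α n * α n
  have h1 : ‖1 - β‖ ^ 2 = 1 - 2 * β.re + ‖β‖ ^ 2 := by
    rw [← Complex.normSq_eq_norm_sq, ← Complex.normSq_eq_norm_sq, Complex.normSq_apply,
      Complex.normSq_apply]
    simp only [Complex.sub_re, Complex.sub_im, Complex.one_re, Complex.one_im]; ring
  rw [h1]
  field_simp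
  ring

lemma gCoeff_mul (hα : ∀ n, ‖α n‖ < 1) (n : ℕ) :
    gCoeff α (n + 1) * (2 * (1 - (tauSeq α n * α n).re)) = ‖1 - tauSeq α n * α n‖ ^ 2 := by
  have h := one_sub_re_pos hα n
  rw [gCoeff, Nat.add_sub_cancel]
  field_simp

/-- Both sides satisfy the same second-order recurrence; the factor 2e^{iθ/2} gained at each step is
what `chainFactor_eq` extracts to leave a real coefficient. -/
lemma paraScale_mul_eq {c d : ℕ → ℝ} {θ : ℝ} {φ ψ : ℕ → ℂ} (hα : ∀ n, ‖α n‖ < 1)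
    (hc : ∀ n, 1 ≤ n → c n = cCoeff α n)
    (hd : ∀ n, 1 ≤ n → d (n + 1) = (1 - gCoeff α n) * gCoeff α (n + 1))
    (h0 : φ 0 = 1) (h0' : ψ 0 = 1)
    (hφ : ∀ n, φ (n + 1) = (Circle.exp θ : ℂ) * φ n - conj (α n) * ψ n)
    (hψ : ∀ n, ψ (n + 1) = ψ n - α n * ((Circle.exp θ : ℂ) * φ n)) (n : ℕ) :
    paraScale α n * ((Circle.exp θ : ℂ) * φ n - tauSeq α n * ψ n) =
      ((Circle.exp θ : ℂ) - 1) * (2 * (Circle.exp (θ / 2) : ℂ)) ^ n * chainPoly c d θ n := by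
  suffices H : ∀ n, (paraScale α n * ((Circle.exp θ : ℂ) * φ n - tauSeq α n * ψ n) =
      ((Circle.exp θ : ℂ) - 1) * (2 * (Circle.exp (θ / 2) : ℂ)) ^ n * chainPoly c d θ n) ∧
      (paraScale α (n + 1) * ((Circle.exp θ : ℂ) * φ (n + 1) - tauSeq α (n + 1) * ψ (n + 1)) =
      ((Circle.exp θ : ℂ) - 1) * (2 * (Circle.exp (θ / 2) : ℂ)) ^ (n + 1) *
        chainPoly c d θ (n + 1)) from (H n).1
  have fac : ∀ n, ((1 - tauSeq α n * α n) * (Circle.exp θ : ℂ) +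
      (1 - conj (tauSeq α n * α n))) =
      ((1 - (tauSeq α n * α n).re : ℝ) : ℂ) *
        (2 * (Circle.exp (θ / 2) : ℂ) * chainFactor c θ (n + 1)) := fun n => by
    have hne : ((1 - (tauSeq α n * α n).re : ℝ) : ℂ) ≠ 0 := by
      exact_mod_cast (one_sub_re_pos hα n).ne'
    obtain ⟨h1, h2⟩ := one_sub_add_I hα n
    rw [div_eq_iff hne] at h1 h2
    rw [← chainFactor_eq, hc (n + 1) (by omega), h1, h2]; ring
  intro n
  induction n with
  | zero =>
    constructor
    · simp [paraScale, tauSeq, h0, h0', chainPoly]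
    · have hne : ((1 - (tauSeq α 0 * α 0).re : ℝ) : ℂ) ≠ 0 := by
        exact_mod_cast (one_sub_re_pos hα 0).ne'
      have hne' := one_sub_tauSeq_mul_ne_zero hα 0
      have hf := fac 0
      simp only [zero_add] at hf ⊢
      have hτ : (1 - tauSeq α 0 * α 0) * tauSeq α 1 = 1 - conj (α 0) := by
        change _ * ((tauSeq α 0 - conj (α 0)) / (1 - tauSeq α 0 * α 0)) = _
        rw [mul_div_cancel₀ _ hne', tauSeq]
      rw [paraScale, paraScale, chainPoly, hφ, hψ, h0, h0', one_mul, pow_one,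
        div_mul_eq_mul_div, div_eq_iff hne]
      simp only [tauSeq, one_mul] at hτ hf ⊢
      linear_combination ((Circle.exp θ : ℂ) - 1) * hf -
        (1 - α 0 * (Circle.exp θ : ℂ)) * hτ
  | succ n ih =>
    refine ⟨ih.2, ?_⟩
    obtain ⟨ih1, ih2⟩ := ih
    have hrec := paraOrthogonal_recurrence hα hφ hψ n
    rw [fac (n + 1)] at hrec
    have hr : ((1 - (tauSeq α n * α n).re : ℝ) : ℂ) ≠ 0 := by
      exact_mod_cast (one_sub_re_pos hα n).ne'
    have hr' : ((1 - (tauSeq α (n + 1) * α (n + 1)).re : ℝ) : ℂ) ≠ 0 := by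
      exact_mod_cast (one_sub_re_pos hα (n + 1)).ne'
    have hdd : (d (n + 2) : ℂ) * (4 * ((1 - (tauSeq α n * α n).re : ℝ) : ℂ) *
        ((1 - (tauSeq α (n + 1) * α (n + 1)).re : ℝ) : ℂ)) =
        (1 - tauSeq α (n + 1) * α (n + 1)) * (1 - conj (tauSeq α (n + 1) * α (n + 1))) *
        (1 - tauSeq α n * α n * conj (tauSeq α n * α n)) := by
      have e1 := one_sub_gCoeff hα n
      have e2 := gCoeff_mul hα (n + 1)
      have e3 : (1 - tauSeq α (n + 1) * α (n + 1)) *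
          (1 - conj (tauSeq α (n + 1) * α (n + 1))) =
          ((‖1 - tauSeq α (n + 1) * α (n + 1)‖ ^ 2 : ℝ) : ℂ) := by
        rw [← Complex.normSq_eq_norm_sq, ← Complex.mul_conj]; simp
      have e4 : 1 - tauSeq α n * α n * conj (tauSeq α n * α n) =
          ((1 - ‖tauSeq α n * α n‖ ^ 2 : ℝ) : ℂ) := by
        rw [Complex.mul_conj, Complex.normSq_eq_norm_sq]; push_cast; ring
      rw [e3, e4, ← e1, ← e2, hd (n + 1) (by omega)]
      push_cast; ring
    rw [← hdd] at hrec
    have hz := Circle.exp_eq_sq_half θ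
    rw [paraScale] at ih2 ⊢
    rw [paraScale, chainPoly]
    rw [show n + 1 + 1 = n + 2 from rfl] at hrec ⊢
    set r := ((1 - (tauSeq α n * α n).re : ℝ) : ℂ)
    set r' := ((1 - (tauSeq α (n + 1) * α (n + 1)).re : ℝ) : ℂ)
    set P := paraScale α n
    set A := 1 - tauSeq α n * α n
    set A' := 1 - tauSeq α (n + 1) * α (n + 1)
    set e := (Circle.exp (θ / 2) : ℂ)
    set q := (Circle.exp θ : ℂ) * φ n - tauSeq α n * ψ n
    set q' := (Circle.exp θ : ℂ) * φ (n + 1) - tauSeq α (n + 1) * ψ (n + 1)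
    set q'' := (Circle.exp θ : ℂ) * φ (n + 2) - tauSeq α (n + 2) * ψ (n + 2)
    have h1 : P * (A / r) * (A' / r') * q'' = P / (r * r') * (A * (A' * q'')) := by
      field_simp
    have h2 : P / (r * r') * (A * (r' * (2 * e * chainFactor c θ (n + 2)) * q') -
        d (n + 2) * (4 * r * r') * (Circle.exp θ : ℂ) * q) =
        2 * e * chainFactor c θ (n + 2) * (P * (A / r) * q') -
          4 * d (n + 2) * (Circle.exp θ : ℂ) * (P * q) := by
      field_simp
    rw [h1, hrec, h2, ih1, ih2]
    simp only [Complex.ofReal_sub, Complex.ofReal_mul]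
    linear_combination -4 * (d (n + 2) : ℂ) * (((Circle.exp θ : ℂ) - 1) * (2 * e) ^ n *
      chainPoly c d θ n) * hz

end Normalized

/-! ### Degenerate weighted forms and zeros of W_n. -/

/-- The trigonometric weight `cos (θ/2) (1 - Re z) - sin (θ/2) Im z`; at `z = e^{iφ}` it equals
`2 sin (φ/2) sin ((φ - θ)/2)`. -/
def arcWeight (θ : ℝ) : C(Circle, ℝ) where
  toFun z := Real.cos (θ / 2) * (1 - (z : ℂ).re) - Real.sin (θ / 2) * (z : ℂ).im
  continuous_toFun := by
    have : Continuous fun z : Circle => (z : ℂ) := continuous_subtype_val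
    have h1 := Complex.continuous_re.comp this
    have h2 := Complex.continuous_im.comp this
    exact (continuous_const.mul (continuous_const.sub h1)).sub (continuous_const.mul h2)

lemma arcWeight_apply (θ : ℝ) (z : Circle) :
    arcWeight θ z = Real.cos (θ / 2) * (1 - (z : ℂ).re) - Real.sin (θ / 2) * (z : ℂ).im := rfl

/-- The extra factor z on the right shifts orthogonality to 1, …, z^{n-1} under the weight into
unweighted orthogonality to z, …, z^n. -/
lemma sub_one_mul_sub_exp (θ : ℝ) (z : Circle) :
    ((z : ℂ) - 1) * ((z : ℂ) - (Circle.exp θ : ℂ)) =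
      -2 * (Circle.exp (θ / 2) : ℂ) * z * (arcWeight θ z : ℂ) := by
  have hz := Circle.coe_mul_conj z
  have he := Circle.coe_mul_conj (Circle.exp (θ / 2))
  have hw : (arcWeight θ z : ℂ) = ((Circle.exp (θ / 2) : ℂ) + conj (Circle.exp (θ / 2) : ℂ) -
      (Circle.exp (θ / 2) : ℂ) * conj (z : ℂ) - conj (Circle.exp (θ / 2) : ℂ) * z) / 2 := by
    rw [arcWeight_apply, Circle.coe_exp_eq]
    apply Complex.ext
    · simp [-Complex.ofReal_cos, -Complex.ofReal_sin]; ring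
    · simp [-Complex.ofReal_cos, -Complex.ofReal_sin]; ring
  rw [Circle.exp_eq_sq_half, hw]
  set e := (Circle.exp (θ / 2) : ℂ)
  linear_combination (z - (z : ℂ) ^ 2) * he - e ^ 2 * hz

/-- If a nonzero polynomial of degree less than `n` is orthogonal to all of them with respect to the
weight `arcWeight θ`, then `θ` is a zero of `W_n`. -/
lemma IsMonicOPUC.chainPoly_eq_zero {μ : Measure Circle} {Φ : ℕ → ℂ[X]}
    (hμ : IsNontrivialProbability μ) (hΦ : IsMonicOPUC μ Φ) {c d : ℕ → ℝ}
    (hc : ∀ n, 1 ≤ n → c n = cCoeff (verblunsky Φ) n)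
    (hd : ∀ n, 1 ≤ n → d (n + 1) = (1 - gCoeff (verblunsky Φ) n) * gCoeff (verblunsky Φ) (n + 1))
    {θ : ℝ} (hθ0 : 0 < θ) (hθ : θ < 2 * Real.pi) {n : ℕ} {p : ℂ[X]} (hp : p ≠ 0)
    (hdeg : p.natDegree < n)
    (h : ∀ k < n, polyForm μ (arcWeight θ) p (Polynomial.X ^ k) = 0) :
    chainPoly c d θ n = 0 := by
  set e : ℂ := (Circle.exp θ : ℂ)
  set Q : ℂ[X] := (Polynomial.X - Polynomial.C 1) * (Polynomial.X - Polynomial.C e) * p with hQ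
  have hQ0 : Q ≠ 0 :=
    mul_ne_zero (mul_ne_zero (Polynomial.X_sub_C_ne_zero _) (Polynomial.X_sub_C_ne_zero _)) hp
  have hQdeg : Q.natDegree ≤ n + 1 := by
    rw [hQ]
    refine Polynomial.natDegree_mul_le.trans ?_
    have := (Polynomial.natDegree_mul_le (p := (Polynomial.X - Polynomial.C (1 : ℂ)))
      (q := Polynomial.X - Polynomial.C e))
    rw [Polynomial.natDegree_X_sub_C, Polynomial.natDegree_X_sub_C] at this
    omega
  have hQ1 : Q.eval 1 = 0 := by simp [hQ]
  have hQe : Q.eval e = 0 := by simp [hQ]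
  have hort : ∀ k < n, polyForm μ 1 Q (Polynomial.X ^ (k + 1)) = 0 := fun k hk => by
    have h1 : polyForm μ 1 Q (Polynomial.X ^ (k + 1)) =
        (-2 * (Circle.exp (θ / 2) : ℂ)) * polyForm μ (arcWeight θ) p (Polynomial.X ^ k) := by
      rw [polyForm, polyForm, ← integral_const_mul]
      congr 1; ext z
      have hz := Circle.coe_mul_conj z
      have hw := sub_one_mul_sub_exp θ z
      simp only [hQ, Polynomial.eval_mul, Polynomial.eval_sub, Polynomial.eval_X,
        Polynomial.eval_C, Polynomial.eval_pow, map_pow, ContinuousMap.one_apply,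
        Complex.ofReal_one, mul_one]
      rw [hw, pow_succ]
      linear_combination (-2 * (Circle.exp (θ / 2) : ℂ) * (arcWeight θ z : ℂ) * p.eval (z : ℂ) *
        conj (z : ℂ) ^ k) * hz
    rw [h1, h k hk, mul_zero]
  have key := hΦ.eq_C_mul_paraOrthogonal hμ hQdeg hQ1 hort
  have hlead : Q.coeff (n + 1) ≠ 0 := fun h0 => by
    rw [h0, map_zero, zero_mul] at key
    exact hQ0 key
  have hq0 : e * (Φ n).eval e - tauSeq (verblunsky Φ) n * (revStar n (Φ n)).eval e = 0 := by
    have := congrArg (Polynomial.eval e) key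
    rw [hQe] at this
    simp only [Polynomial.eval_mul, Polynomial.eval_C, Polynomial.eval_sub,
      Polynomial.eval_X] at this
    exact (mul_eq_zero.1 this.symm).resolve_left hlead
  have hW := paraScale_mul_eq (θ := θ) (φ := fun n => (Φ n).eval e)
    (ψ := fun n => (revStar n (Φ n)).eval e) (hΦ.norm_verblunsky_lt_one hμ) hc hd
    (by simp [hΦ.eval_zero_index])
    (by
      have := revStar_eval (hΦ.natDegree_eq 0).le (Circle.exp θ)
      rw [this]; simp [hΦ.eval_zero_index])
    (fun n => hΦ.szego_eval hμ n _) (fun n => hΦ.szego_revStar_eval hμ n _) n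
  rw [hq0, mul_zero] at hW
  -- The prefactor z - 1 must be cancelled; this uses 0 < θ < 2π.
  have he1 : e - 1 ≠ 0 := fun h0 => by
    have h1 : Circle.exp θ = 1 := Subtype.ext (sub_eq_zero.1 h0)
    rw [Circle.exp_eq_one] at h1
    obtain ⟨m, hm⟩ := h1
    have hpi := Real.pi_pos
    have hm0 : (0 : ℝ) < m := by
      by_contra hcon; push Not at hcon; nlinarith
    have hm1 : (m : ℝ) < 1 := by
      by_contra hcon; push Not at hcon; nlinarith
    norm_cast at hm0 hm1
    omega
  have h2 := mul_eq_zero.1 hW.symm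
  rcases h2 with h2 | h2
  · exact absurd h2 (mul_ne_zero he1 (pow_ne_zero _
      (mul_ne_zero two_ne_zero (Circle.coe_ne_zero _))))
  · exact_mod_cast h2

/-! ### A Rayleigh quotient argument for Hermitian pencils. -/

section Rayleigh

open Matrix
open scoped ComplexOrder

lemma continuous_re_star_dotProduct {n : ℕ} (M : Matrix (Fin n) (Fin n) ℂ) :
    Continuous fun x : Fin n → ℂ => (star x ⬝ᵥ M *ᵥ x).re := by
  refine Complex.continuous_re.comp ?_
  fun_prop

/-- If no `M - λ N` with `λ > λ₀` is singular, then `λ₀ N - M` is positive semidefinite. -/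
lemma posSemidef_of_forall_gt_ker {n : ℕ} {M N : Matrix (Fin n) (Fin n) ℂ} (hM : M.IsHermitian)
    (hN : N.PosDef) {l₀ : ℝ}
    (h : ∀ l : ℝ, l₀ < l → ∀ x : Fin n → ℂ, ((l : ℂ) • N - M) *ᵥ x = 0 → x = 0) :
    ((l₀ : ℂ) • N - M).PosSemidef := by
  have herm : ∀ l : ℝ, ((l : ℂ) • N - M).IsHermitian := fun l => by
    refine IsHermitian.sub ?_ hM
    rw [IsHermitian, conjTranspose_smul, hN.1.eq]; simp
  have hform : ∀ (l : ℝ) (x : Fin n → ℂ), star x ⬝ᵥ ((l : ℂ) • N - M) *ᵥ x =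
      ((l * (star x ⬝ᵥ N *ᵥ x).re - (star x ⬝ᵥ M *ᵥ x).re : ℝ) : ℂ) := fun l x => by
    have h1 := hM.im_star_dotProduct_mulVec_self x
    have h2 := hN.1.im_star_dotProduct_mulVec_self x
    rw [sub_mulVec, smul_mulVec, dotProduct_sub, dotProduct_smul, smul_eq_mul]
    apply Complex.ext
    · simp
    · simp at h1 h2 ⊢
      simp [h1, h2]
  rcases subsingleton_or_nontrivial (Fin n → ℂ) with hs | hs
  · refine PosSemidef.of_dotProduct_mulVec_nonneg (herm _) fun x => ?_
    rw [Subsingleton.elim x 0]; simp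
  have hNpos : ∀ x : Fin n → ℂ, x ≠ 0 → 0 < (star x ⬝ᵥ N *ᵥ x).re := fun x hx =>
    (Complex.pos_iff.1 (hN.dotProduct_mulVec_pos hx)).1
  have hsph : ∀ x ∈ Metric.sphere (0 : Fin n → ℂ) 1, x ≠ 0 := fun x hx => by
    rintro rfl; simp at hx
  -- This is the sphere of the sup norm; the quotient is homogeneous of degree 0, so any compact set
  -- meeting every ray serves. Its maximum `l` makes lN - M semidefinite and singular, which forces
  -- l ≤ l₀.
  obtain ⟨x₀, hx₀, hmax⟩ := (isCompact_sphere (0 : Fin n → ℂ) 1).exists_isMaxOn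
    (NormedSpace.sphere_nonempty.2 zero_le_one)
    (((continuous_re_star_dotProduct M).continuousOn).div
      ((continuous_re_star_dotProduct N).continuousOn) fun x hx => (hNpos x (hsph x hx)).ne')
  set l := (star x₀ ⬝ᵥ M *ᵥ x₀).re / (star x₀ ⬝ᵥ N *ᵥ x₀).re with hl
  have hle : ∀ x : Fin n → ℂ, (star x ⬝ᵥ M *ᵥ x).re ≤ l * (star x ⬝ᵥ N *ᵥ x).re := fun x => by
    rcases eq_or_ne x 0 with rfl | hx
    · simp
    have hnx : ‖x‖ ≠ 0 := norm_ne_zero_iff.2 hx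
    have hm := hmax (show ((‖x‖⁻¹ : ℝ) : ℂ) • x ∈ Metric.sphere (0 : Fin n → ℂ) 1 by
      simp [norm_smul, hnx])
    have hsc : ∀ K : Matrix (Fin n) (Fin n) ℂ,
        (star (((‖x‖⁻¹ : ℝ) : ℂ) • x) ⬝ᵥ K *ᵥ (((‖x‖⁻¹ : ℝ) : ℂ) • x)).re =
          (‖x‖⁻¹) ^ 2 * (star x ⬝ᵥ K *ᵥ x).re := fun K => by
      rw [mulVec_smul, dotProduct_smul, star_smul, smul_dotProduct, smul_eq_mul, smul_eq_mul,
        ← mul_assoc, Complex.star_def, Complex.conj_ofReal, ← Complex.ofReal_mul,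
        Complex.re_ofReal_mul, sq]
    have hm' : (star (((‖x‖⁻¹ : ℝ) : ℂ) • x) ⬝ᵥ M *ᵥ (((‖x‖⁻¹ : ℝ) : ℂ) • x)).re /
      (star (((‖x‖⁻¹ : ℝ) : ℂ) • x) ⬝ᵥ N *ᵥ (((‖x‖⁻¹ : ℝ) : ℂ) • x)).re ≤ l := hm
    rw [hsc, hsc, mul_div_mul_left _ _ (pow_ne_zero 2 (inv_ne_zero hnx)),
      div_le_iff₀ (hNpos x hx)] at hm'
    exact hm'
  have hpsd : ((l : ℂ) • N - M).PosSemidef := by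
    refine PosSemidef.of_dotProduct_mulVec_nonneg (herm _) fun x => ?_
    rw [hform]
    exact_mod_cast sub_nonneg.2 (hle x)
  have hker : ((l : ℂ) • N - M) *ᵥ x₀ = 0 := by
    rw [← hpsd.dotProduct_mulVec_zero_iff, hform, hl,
      div_mul_cancel₀ _ (hNpos x₀ (hsph x₀ hx₀)).ne']
    simp
  have hll : l ≤ l₀ := by
    by_contra hcon
    exact hsph x₀ hx₀ (h l (not_le.1 hcon) x₀ hker)
  refine PosSemidef.of_dotProduct_mulVec_nonneg (herm _) fun x => ?_
  rw [hform]
  have h0 : 0 ≤ (star x ⬝ᵥ N *ᵥ x).re :=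
    (Complex.nonneg_iff.1 (hN.posSemidef.dotProduct_mulVec_nonneg x)).1
  exact_mod_cast sub_nonneg.2 ((hle x).trans (mul_le_mul_of_nonneg_right hll h0))

end Rayleigh

/-! ### From positivity on polynomials to positivity almost everywhere. -/

/-- Trigonometric polynomials as a star subalgebra of the continuous functions on the circle. -/
def trigPolynomials : StarSubalgebra ℂ C(Circle, ℂ) where
  carrier := {f | ∃ (m : ℕ) (p : ℂ[X]), ∀ z : Circle, (z : ℂ) ^ m * f z = p.eval (z : ℂ)}
  mul_mem' := by
    rintro f g ⟨m, p, hp⟩ ⟨k, q, hq⟩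
    refine ⟨m + k, p * q, fun z => ?_⟩
    rw [Polynomial.eval_mul, ← hp, ← hq, ContinuousMap.mul_apply]; ring
  add_mem' := by
    rintro f g ⟨m, p, hp⟩ ⟨k, q, hq⟩
    refine ⟨m + k, Polynomial.X ^ k * p + Polynomial.X ^ m * q, fun z => ?_⟩
    simp only [Polynomial.eval_add, Polynomial.eval_mul, Polynomial.eval_pow, Polynomial.eval_X,
      ← hp, ← hq, ContinuousMap.add_apply]
    ring
  algebraMap_mem' a := ⟨0, Polynomial.C a, fun z => by simp⟩
  star_mem' := by
    rintro f ⟨m, p, hp⟩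
    refine ⟨p.natDegree, Polynomial.X ^ m * revStar p.natDegree p, fun z => ?_⟩
    have hz : (z : ℂ) ^ m * conj (z : ℂ) ^ m = 1 := by
      rw [← mul_pow, Circle.coe_mul_conj, one_pow]
    rw [Polynomial.eval_mul, revStar_eval le_rfl, ← hp]
    simp only [Polynomial.eval_pow, Polynomial.eval_X, map_mul, map_pow, ContinuousMap.star_apply,
      Complex.star_def]
    linear_combination -((z : ℂ) ^ p.natDegree * conj (f z)) * hz

lemma trigPolynomials_topologicalClosure : trigPolynomials.topologicalClosure = ⊤ := by
  apply ContinuousMap.starSubalgebra_topologicalClosure_eq_top_of_separatesPoints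
  intro x y hxy
  refine ⟨fun z : Circle => (z : ℂ),
    ⟨⟨fun z : Circle => (z : ℂ), continuous_subtype_val⟩, ?_, rfl⟩, fun h => hxy (Subtype.ext h)⟩
  refine ⟨0, Polynomial.X, fun z => ?_⟩
  rw [pow_zero, one_mul, Polynomial.eval_X]
  rfl

/-- A weight that is nonnegative on squares of polynomials is nonnegative almost everywhere. -/
lemma ae_nonneg_of_forall_polynomial {μ : Measure Circle} [IsFiniteMeasure μ] (w : C(Circle, ℝ))
    (h : ∀ p : ℂ[X], 0 ≤ ∫ z : Circle, ‖p.eval (z : ℂ)‖ ^ 2 * w z ∂μ) :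
    ∀ᵐ z ∂μ, 0 ≤ w z := by
  have hcont : ∀ f : C(Circle, ℂ), 0 ≤ ∫ z, ‖f z‖ ^ 2 * w z ∂μ := by
    intro f
    have hf : f ∈ closure (trigPolynomials : Set C(Circle, ℂ)) := by
      have : f ∈ trigPolynomials.topologicalClosure := by
        rw [trigPolynomials_topologicalClosure]; trivial
      exact this
    have hcts : Continuous fun f : C(Circle, ℂ) => ∫ z, ‖f z‖ ^ 2 * w z ∂μ := by
      rw [continuous_iff_continuousAt]
      intro f₀
      refine continuousAt_of_dominated (bound := fun _ => (‖f₀‖ + 1) ^ 2 * ‖w‖)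
        (Filter.Eventually.of_forall fun g =>
          (integrable_circle (by fun_prop)).aestronglyMeasurable) ?_ (integrable_const _)
        (Filter.Eventually.of_forall fun z => ?_)
      · have hlt : ∀ᶠ g : C(Circle, ℂ) in nhds f₀, ‖g‖ < ‖f₀‖ + 1 :=
          continuous_norm.continuousAt.eventually_lt continuousAt_const (lt_add_one _)
        filter_upwards [hlt] with g hg
        refine Filter.Eventually.of_forall fun z => ?_
        rw [norm_mul, norm_pow, norm_norm]
        have h1 := g.norm_coe_le_norm z
        have h2 := w.norm_coe_le_norm z
        gcongr
        exact h1.trans hg.le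
      · exact ((((continuous_eval_const z).norm).pow 2).mul
          continuous_const).continuousAt
    refine closure_minimal ?_ (isClosed_le continuous_const hcts) hf
    rintro g ⟨m, p, hp⟩
    change 0 ≤ ∫ z, ‖g z‖ ^ 2 * w z ∂μ
    convert h p using 4 with z
    rw [← hp z, norm_mul, norm_pow, Circle.norm_coe, one_pow, one_mul]
  have hneg : Continuous fun z => max (-w z) 0 := by fun_prop
  -- The test function is the square root of the negative part of w, for which |f|² w = -(w⁻)².
  have h1 := hcont ⟨fun z => ((√(max (-w z) 0) : ℝ) : ℂ), by fun_prop⟩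
  have h2 : ∀ z, ‖((√(max (-w z) 0) : ℝ) : ℂ)‖ ^ 2 * w z = -(max (-w z) 0) ^ 2 := fun z => by
    rw [Complex.norm_real, Real.norm_eq_abs, sq_abs, Real.sq_sqrt (le_max_right _ _)]
    rcases le_total (-w z) 0 with h | h
    · rw [max_eq_right h]; simp
    · rw [max_eq_left h]; ring
  simp only [ContinuousMap.coe_mk, h2, integral_neg] at h1
  have h3 : ∫ z, (max (-w z) 0) ^ 2 ∂μ = 0 :=
    le_antisymm (by linarith) (integral_nonneg fun z => sq_nonneg _)
  have h4 := (integral_eq_zero_iff_of_nonneg (fun z => sq_nonneg _)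
    (integrable_circle (hneg.pow 2))).1 h3
  filter_upwards [h4] with z hz
  have h5 : max (-w z) 0 = 0 := pow_eq_zero_iff two_ne_zero |>.1 hz
  have := le_max_left (-w z) 0
  rw [h5] at this
  linarith

/-! ### The weight as a linear pencil in l = cot(θ/2). -/

/-- The weight `1 - Re z`. -/
def oneSubReWeight : C(Circle, ℝ) where
  toFun z := 1 - (z : ℂ).re
  continuous_toFun := continuous_const.sub (Complex.continuous_re.comp continuous_subtype_val)

/-- The weight `Im z`. -/
def imWeight : C(Circle, ℝ) where
  toFun z := (z : ℂ).im
  continuous_toFun := Complex.continuous_im.comp continuous_subtype_val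

/-- The weight `l (1 - Re z) - Im z`. -/
def cotWeight (l : ℝ) : C(Circle, ℝ) := l • oneSubReWeight - imWeight

lemma cotWeight_apply (l : ℝ) (z : Circle) :
    cotWeight l z = l * (1 - (z : ℂ).re) - (z : ℂ).im := rfl

/-- The angle `θ` in `(0, 2π)` with `cot (θ / 2) = l`. -/
def cotAngle (l : ℝ) : ℝ := Real.pi - 2 * Real.arctan l

lemma cotAngle_pos (l : ℝ) : 0 < cotAngle l := by
  have := Real.arctan_lt_pi_div_two l
  unfold cotAngle; linarith

lemma cotAngle_lt (l : ℝ) : cotAngle l < 2 * Real.pi := by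
  have := Real.neg_pi_div_two_lt_arctan l
  unfold cotAngle; linarith

lemma cotAngle_lt_cotAngle {l l' : ℝ} : cotAngle l < cotAngle l' ↔ l' < l := by
  rw [← Real.arctan_lt_arctan_iff (x := l')]
  unfold cotAngle
  constructor <;> intro h <;> linarith

lemma exists_cotAngle_eq {θ : ℝ} (h0 : 0 < θ) (h1 : θ < 2 * Real.pi) :
    ∃ l, cotAngle l = θ := by
  refine ⟨Real.tan (Real.pi / 2 - θ / 2), ?_⟩
  rw [cotAngle, Real.arctan_tan (by linarith) (by linarith)]
  ring

lemma arcWeight_cotAngle (l : ℝ) (z : Circle) :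
    arcWeight (cotAngle l) z = Real.cos (Real.arctan l) * cotWeight l z := by
  have h : cotAngle l / 2 = Real.pi / 2 - Real.arctan l := by unfold cotAngle; ring
  have h2 : Real.sin (Real.arctan l) = l * Real.cos (Real.arctan l) := by
    rw [← Real.tan_mul_cos (Real.cos_arctan_pos l).ne', Real.tan_arctan]
  rw [arcWeight_apply, cotWeight_apply, h, Real.cos_pi_div_two_sub, Real.sin_pi_div_two_sub, h2]
  ring

lemma polyForm_arcWeight_cotAngle (μ : Measure Circle) (l : ℝ) (p q : ℂ[X]) :
    polyForm μ (arcWeight (cotAngle l)) p q =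
      (Real.cos (Real.arctan l) : ℂ) * polyForm μ (cotWeight l) p q := by
  rw [polyForm, polyForm, ← integral_const_mul]
  congr 1; ext z
  rw [arcWeight_cotAngle, Complex.ofReal_mul]; ring

lemma polyForm_cotWeight {μ : Measure Circle} [IsFiniteMeasure μ] (l : ℝ) (p q : ℂ[X]) :
    polyForm μ (cotWeight l) p q =
      (l : ℂ) * polyForm μ oneSubReWeight p q - polyForm μ imWeight p q := by
  rw [polyForm, polyForm, polyForm, ← integral_const_mul, ← integral_sub
    ((integrable_circle (continuous_polyForm_integrand _ p q)).const_mul _)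
    (integrable_circle (continuous_polyForm_integrand _ p q))]
  congr 1; ext z
  rw [cotWeight, ContinuousMap.sub_apply, ContinuousMap.smul_apply, smul_eq_mul]
  push_cast; ring

/-! ### Gram matrices and arcs free of mass. -/

section Gram

open Matrix
open scoped ComplexOrder

/-- The polynomial with coefficient vector `x`. -/
def vecPoly {n : ℕ} (x : Fin n → ℂ) : ℂ[X] := ∑ k, Polynomial.C (x k) * Polynomial.X ^ (k : ℕ)

lemma vecPoly_coeff {n : ℕ} (x : Fin n → ℂ) (k : Fin n) : (vecPoly x).coeff k = x k := by
  rw [vecPoly, Polynomial.finsetSum_coeff, Finset.sum_eq_single k]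
  · simp
  · intro b _ hb
    rw [Polynomial.coeff_C_mul_X_pow, if_neg]
    exact fun h => hb (Fin.ext h.symm)
  · simp

lemma vecPoly_ne_zero {n : ℕ} {x : Fin n → ℂ} (hx : x ≠ 0) : vecPoly x ≠ 0 := fun h =>
  hx (funext fun k => by rw [← vecPoly_coeff x k, h]; simp)

lemma vecPoly_natDegree_lt {n : ℕ} {x : Fin n → ℂ} (hx : x ≠ 0) :
    (vecPoly x).natDegree < n := by
  rw [Polynomial.natDegree_lt_iff_degree_lt (vecPoly_ne_zero hx), vecPoly]
  rw [Polynomial.degree_lt_iff_coeff_zero]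
  intro m hm
  rw [Polynomial.finsetSum_coeff]
  refine Finset.sum_eq_zero fun k _ => ?_
  rw [Polynomial.coeff_C_mul_X_pow, if_neg (by omega)]

lemma exists_vecPoly_eq (p : ℂ[X]) : ∃ (n : ℕ) (x : Fin n → ℂ), vecPoly x = p := by
  refine ⟨p.natDegree + 1, fun k => p.coeff k, ?_⟩
  conv_rhs => rw [p.as_sum_range_C_mul_X_pow]
  rw [vecPoly, Finset.sum_range]

/-- The Gram matrix of the monomials for the form with weight `w`. -/
def gramMatrix (μ : Measure Circle) (w : C(Circle, ℝ)) (n : ℕ) : Matrix (Fin n) (Fin n) ℂ :=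
  Matrix.of fun j k => polyForm μ w (Polynomial.X ^ (k : ℕ)) (Polynomial.X ^ (j : ℕ))

variable {μ : Measure Circle}

lemma gramMatrix_isHermitian (w : C(Circle, ℝ)) (n : ℕ) : (gramMatrix μ w n).IsHermitian := by
  ext j k
  simp only [gramMatrix, conjTranspose_apply, of_apply, Complex.star_def, polyForm_conj_symm]

lemma gramMatrix_mulVec [IsFiniteMeasure μ] (w : C(Circle, ℝ)) {n : ℕ} (x : Fin n → ℂ)
    (j : Fin n) :
    (gramMatrix μ w n *ᵥ x) j = polyForm μ w (vecPoly x) (Polynomial.X ^ (j : ℕ)) := by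
  rw [vecPoly, polyForm_sum_left, mulVec, dotProduct]
  refine Finset.sum_congr rfl fun k _ => ?_
  rw [polyForm_C_mul_left, gramMatrix, of_apply, mul_comm]

lemma star_dotProduct_gramMatrix_mulVec [IsFiniteMeasure μ] (w : C(Circle, ℝ)) {n : ℕ}
    (x : Fin n → ℂ) :
    star x ⬝ᵥ gramMatrix μ w n *ᵥ x = polyForm μ w (vecPoly x) (vecPoly x) := by
  conv_rhs => rw [show polyForm μ w (vecPoly x) (vecPoly x) = polyForm μ w (vecPoly x)
    (∑ k, Polynomial.C (x k) * Polynomial.X ^ (k : ℕ)) from rfl, polyForm_sum_right]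
  rw [dotProduct]
  refine Finset.sum_congr rfl fun k _ => ?_
  rw [gramMatrix_mulVec, polyForm_C_mul_right]; rfl

lemma gramMatrix_cotWeight [IsFiniteMeasure μ] (l : ℝ) (n : ℕ) :
    gramMatrix μ (cotWeight l) n =
      (l : ℂ) • gramMatrix μ oneSubReWeight n - gramMatrix μ imWeight n := by
  ext j k
  simp only [gramMatrix, of_apply, Matrix.sub_apply, Matrix.smul_apply, smul_eq_mul, polyForm_cotWeight]

/-- The weight vanishes only at 1, and the support of μ is infinite. -/
lemma gramMatrix_oneSubReWeight_posDef (hμ : IsNontrivialProbability μ) (n : ℕ) :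
    (gramMatrix μ oneSubReWeight n).PosDef := by
  have := hμ.isProbability
  have hw : ∀ z, 0 ≤ oneSubReWeight z := fun z => by
    have h1 := Complex.re_le_norm (z : ℂ)
    rw [Circle.norm_coe] at h1
    exact sub_nonneg.2 h1
  have hfin : {z | oneSubReWeight z = 0}.Finite := by
    refine (Set.finite_singleton (1 : Circle)).subset fun z hz => ?_
    have h1 : (z : ℂ).re = 1 := (sub_eq_zero.1 hz).symm
    have h2 := Circle.normSq_coe z
    rw [Complex.normSq_apply, h1] at h2
    have h3 : (z : ℂ).im = 0 := by nlinarith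
    exact Subtype.ext (Complex.ext h1 h3)
  refine PosDef.of_dotProduct_mulVec_pos (gramMatrix_isHermitian _ _) fun x hx => ?_
  rw [star_dotProduct_gramMatrix_mulVec]
  have hne : polyForm μ oneSubReWeight (vecPoly x) (vecPoly x) ≠ 0 := fun h =>
    vecPoly_ne_zero hx (eq_zero_of_polyForm_self hμ hw hfin h)
  rw [polyForm_self] at hne ⊢
  have h0 : 0 ≤ ∫ z : Circle, ‖(vecPoly x).eval (z : ℂ)‖ ^ 2 * oneSubReWeight z ∂μ :=
    integral_nonneg fun z => mul_nonneg (sq_nonneg _) (hw z)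
  have h1 := lt_of_le_of_ne h0 fun h => hne (by rw [← h]; simp)
  exact_mod_cast h1

variable {Φ : ℕ → ℂ[X]} {c d : ℕ → ℝ}

lemma IsMonicOPUC.gramMatrix_cotWeight_ker (hμ : IsNontrivialProbability μ)
    (hΦ : IsMonicOPUC μ Φ) (hc : ∀ n, 1 ≤ n → c n = cCoeff (verblunsky Φ) n)
    (hd : ∀ n, 1 ≤ n → d (n + 1) = (1 - gCoeff (verblunsky Φ) n) * gCoeff (verblunsky Φ) (n + 1))
    {l : ℝ} {n : ℕ} (hW : chainPoly c d (cotAngle l) n ≠ 0) {x : Fin n → ℂ}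
    (hx : gramMatrix μ (cotWeight l) n *ᵥ x = 0) : x = 0 := by
  have := hμ.isProbability
  by_contra hx0
  refine hW (hΦ.chainPoly_eq_zero hμ hc hd (cotAngle_pos l) (cotAngle_lt l) (vecPoly_ne_zero hx0)
    (vecPoly_natDegree_lt hx0) fun k hk => ?_)
  rw [polyForm_arcWeight_cotAngle, ← gramMatrix_mulVec _ x ⟨k, hk⟩, hx]
  simp

/-- If no `W_n` vanishes at angles below `cotAngle l₀`, then `μ` has no mass on the open arc from
`1` to `cotAngle l₀`. -/
lemma IsMonicOPUC.ae_cotWeight_nonneg (hμ : IsNontrivialProbability μ)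
    (hΦ : IsMonicOPUC μ Φ) (hc : ∀ n, 1 ≤ n → c n = cCoeff (verblunsky Φ) n)
    (hd : ∀ n, 1 ≤ n → d (n + 1) = (1 - gCoeff (verblunsky Φ) n) * gCoeff (verblunsky Φ) (n + 1))
    {l₀ : ℝ} (hW : ∀ l, l₀ < l → ∀ n, chainPoly c d (cotAngle l) n ≠ 0) :
    ∀ᵐ z ∂μ, 0 ≤ cotWeight l₀ z := by
  have := hμ.isProbability
  refine ae_nonneg_of_forall_polynomial _ fun p => ?_
  obtain ⟨n, x, rfl⟩ := exists_vecPoly_eq p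
  have h := posSemidef_of_forall_gt_ker (gramMatrix_isHermitian (μ := μ) imWeight _)
    (gramMatrix_oneSubReWeight_posDef hμ n) (l₀ := l₀) fun l hl y hy => by
      rw [← gramMatrix_cotWeight] at hy
      exact hΦ.gramMatrix_cotWeight_ker hμ hc hd (hW l hl _) hy
  rw [← gramMatrix_cotWeight] at h
  have h1 := h.dotProduct_mulVec_nonneg x
  rw [star_dotProduct_gramMatrix_mulVec, polyForm_self] at h1
  exact_mod_cast h1

/-- If no `W_n` vanishes at angles above `cotAngle l₀`, then `μ` has no mass on the open arc from
`cotAngle l₀` to `1`. -/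
lemma IsMonicOPUC.ae_cotWeight_nonpos (hμ : IsNontrivialProbability μ)
    (hΦ : IsMonicOPUC μ Φ) (hc : ∀ n, 1 ≤ n → c n = cCoeff (verblunsky Φ) n)
    (hd : ∀ n, 1 ≤ n → d (n + 1) = (1 - gCoeff (verblunsky Φ) n) * gCoeff (verblunsky Φ) (n + 1))
    {l₀ : ℝ} (hW : ∀ l, l < l₀ → ∀ n, chainPoly c d (cotAngle l) n ≠ 0) :
    ∀ᵐ z ∂μ, cotWeight l₀ z ≤ 0 := by
  have := hμ.isProbability
  -- Replacing Im z by -Im z and l by -l reverses the order of angles, so the same Rayleigh argument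
  -- serves the other end.
  have hneg : ∀ (l : ℝ) (n : ℕ), (l : ℂ) • gramMatrix μ oneSubReWeight n - -gramMatrix μ imWeight n
      = -gramMatrix μ (cotWeight (-l)) n := fun l n => by
    rw [gramMatrix_cotWeight, Complex.ofReal_neg, neg_smul]; abel
  have key : ∀ᵐ z ∂μ, 0 ≤ (-cotWeight l₀) z := by
    refine ae_nonneg_of_forall_polynomial _ fun p => ?_
    obtain ⟨n, x, rfl⟩ := exists_vecPoly_eq p
    have h := posSemidef_of_forall_gt_ker (gramMatrix_isHermitian (μ := μ) imWeight _).neg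
      (gramMatrix_oneSubReWeight_posDef hμ n) (l₀ := -l₀) fun l hl y hy => by
        rw [hneg, neg_mulVec, neg_eq_zero] at hy
        exact hΦ.gramMatrix_cotWeight_ker hμ hc hd (hW (-l) (by linarith) _) hy
    rw [hneg, neg_neg] at h
    have h1 := h.dotProduct_mulVec_nonneg x
    rw [neg_mulVec, dotProduct_neg, star_dotProduct_gramMatrix_mulVec, polyForm_self,
      ← Complex.ofReal_neg, ← integral_neg] at h1
    have h2 := Complex.zero_le_real.1 h1
    convert h2 using 3 with z
    rw [ContinuousMap.neg_apply, mul_neg]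
  filter_upwards [key] with z hz
  exact neg_nonneg.1 hz

end Gram

/-! ### Chain sequences and zero-free ranges of θ. -/

section Chain

variable {d q : ℕ → ℝ}

lemma IsScalingSeq.qOne_pos (hq : IsScalingSeq d q) {n : ℕ} (hn : 1 ≤ n) : 0 < qOne q n := by
  unfold qOne
  split_ifs with h
  · exact hq.pos 1 le_rfl
  · exact lt_max_of_lt_right (hq.pos n hn)

lemma IsScalingSeq.qOne_le_one (hq : IsScalingSeq d q) {n : ℕ} (hn : 1 ≤ n) : qOne q n ≤ 1 := by
  unfold qOne
  split_ifs with h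
  · exact hq.le_one 1 le_rfl
  · have := hq.le_one (n - 1) (by omega)
    rw [Nat.sub_add_cancel hn] at this
    exact max_le this (hq.le_one n hn)

lemma le_qOne (q : ℕ → ℝ) (n : ℕ) : q (n + 1) ≤ qOne q n := by
  unfold qOne
  split_ifs with h
  · rw [h]
  · exact le_max_right _ _

lemma le_qOne_succ (q : ℕ → ℝ) {n : ℕ} (hn : 1 ≤ n) : q (n + 1) ≤ qOne q (n + 1) := by
  rw [qOne, if_neg (by omega)]
  exact le_max_left _ _

/-- Positivity of a three-term recurrence whose coefficients dominate the scaling sequence. -/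
lemma IsScalingSeq.recurrence_pos (hq : IsScalingSeq d q) {l W : ℕ → ℝ}
    (hl : ∀ n, 1 ≤ n → √(qOne q n) ≤ l n) (h0 : W 0 = 1) (h1 : W 1 = l 1)
    (hW : ∀ n, W (n + 2) = l (n + 2) * W (n + 1) - d (n + 2) * W n) (n : ℕ) : 0 < W n := by
  obtain ⟨g, hg⟩ := hq.chain
  have hlpos : ∀ n, 1 ≤ n → 0 < l n := fun n hn =>
    (Real.sqrt_pos.2 (hq.qOne_pos hn)).trans_le (hl n hn)
  have hg1 : ∀ n, 1 ≤ n → 0 < 1 - g n := fun n hn => by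
    rcases eq_or_lt_of_le hn with rfl | h
    · exact sub_pos.2 hg.first_lt_one
    · exact sub_pos.2 (hg.lt_one n h)
  -- The invariant bounds W_{n+1}/W_n below by l_{n+1}(1 - g_{n+1}), with g a parameter sequence of
  -- d/q.
  suffices H : ∀ n, 0 < W n ∧ l (n + 1) * (1 - g (n + 1)) * W n ≤ W (n + 1) from (H n).1
  intro n
  induction n with
  | zero =>
    rw [h0, h1]
    refine ⟨one_pos, ?_⟩
    have h2 := hlpos 1 le_rfl
    have h3 := hg.first_nonneg
    simp only [zero_add]
    nlinarith
  | succ n ih =>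
    obtain ⟨ih1, ih2⟩ := ih
    have hl1 := hlpos (n + 1) (by omega)
    have hl2 := hlpos (n + 2) (by omega)
    have hgn := hg1 (n + 1) (by omega)
    have hW1 : 0 < W (n + 1) := (mul_pos (mul_pos hl1 hgn) ih1).trans_le ih2
    refine ⟨hW1, ?_⟩
    have hqpos := hq.pos (n + 1) (by omega)
    -- The maximum in q^{(1)} is there for this: q_{n+2} enters both q^{(1)}_{n+1} and
    -- q^{(1)}_{n+2}.
    have hqll : q (n + 2) ≤ l (n + 1) * l (n + 2) := by
      have e1 : √(q (n + 2)) ≤ l (n + 1) :=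
        (Real.sqrt_le_sqrt (le_qOne q (n + 1))).trans (hl _ (by omega))
      have e2 : √(q (n + 2)) ≤ l (n + 2) :=
        (Real.sqrt_le_sqrt (le_qOne_succ q (by omega))).trans (hl _ (by omega))
      calc q (n + 2) = √(q (n + 2)) * √(q (n + 2)) := (Real.mul_self_sqrt hqpos.le).symm
        _ ≤ l (n + 1) * l (n + 2) := mul_le_mul e1 e2 (Real.sqrt_nonneg _) hl1.le
    have hd : d (n + 2) = q (n + 2) * ((1 - g (n + 1)) * g (n + 2)) := by
      rw [← hg.eq_mul (n + 1) (by omega)]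
      exact (mul_div_cancel₀ _ hqpos.ne').symm
    have hgp := hg.pos (n + 2) (by omega)
    have hdW : d (n + 2) * W n ≤ l (n + 2) * g (n + 2) * W (n + 1) := by
      rw [hd]
      calc q (n + 2) * ((1 - g (n + 1)) * g (n + 2)) * W n
          ≤ (l (n + 1) * l (n + 2)) * ((1 - g (n + 1)) * g (n + 2)) * W n := by gcongr
        _ = l (n + 2) * g (n + 2) * (l (n + 1) * (1 - g (n + 1)) * W n) := by ring
        _ ≤ l (n + 2) * g (n + 2) * W (n + 1) := by gcongr
    rw [hW n]
    linarith

lemma IsScalingSeq.chainPoly_ne_zero_of_le (hq : IsScalingSeq d q) {c : ℕ → ℝ} {θ : ℝ}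
    (h : ∀ n, 1 ≤ n → √(qOne q n) ≤ chainFactor c θ n) (n : ℕ) : chainPoly c d θ n ≠ 0 :=
  (hq.recurrence_pos h (by rw [chainPoly]) (by rw [chainPoly]) (fun n => by rw [chainPoly]) n).ne'

lemma IsScalingSeq.chainPoly_ne_zero_of_le_neg (hq : IsScalingSeq d q) {c : ℕ → ℝ} {θ : ℝ}
    (h : ∀ n, 1 ≤ n → chainFactor c θ n ≤ -√(qOne q n)) (n : ℕ) : chainPoly c d θ n ≠ 0 := by
  have := hq.recurrence_pos (l := fun n => -chainFactor c θ n)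
    (W := fun n => (-1) ^ n * chainPoly c d θ n) (fun n hn => le_neg.1 (h n hn))
    (by simp [chainPoly]) (by simp [chainPoly]) (fun n => by simp only [chainPoly]; ring) n
  exact fun h0 => by simp [h0] at this

lemma chainFactor_eq_quarter (c : ℕ → ℝ) (θ : ℝ) (n : ℕ) :
    chainFactor c θ n = Real.cos (θ / 4) ^ 2 - Real.sin (θ / 4) ^ 2 -
      2 * c n * Real.sin (θ / 4) * Real.cos (θ / 4) := by
  have h : θ / 2 = 2 * (θ / 4) := by ring
  rw [chainFactor, h, Real.cos_two_mul', Real.sin_two_mul]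
  ring

lemma sqrt_add_props {c Q : ℝ} (h1 : Q ≤ 1) :
    √(c ^ 2 + (1 - Q)) ^ 2 = c ^ 2 + (1 - Q) ∧ |c| ≤ √(c ^ 2 + (1 - Q)) := by
  refine ⟨Real.sq_sqrt (by nlinarith [sq_nonneg c]), ?_⟩
  exact Real.abs_le_sqrt (by linarith)

/-- With r = √q_n^{(1)} and x = cot(θ/4) the claim is (1 - r)x² - 2c_n x - (1 + r) ≥ 0. For r < 1,
v_{1,n} is the positive root, written with a denominator that also covers r = 1. -/
lemma sqrt_qOne_le_chainFactor {c : ℕ → ℝ} {n : ℕ} (h0 : 0 < qOne q n) (h1 : qOne q n ≤ 1)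
    {θ : ℝ} (hs : 0 < Real.sin (θ / 4)) (hc : 0 < Real.cos (θ / 4))
    (h : vOne c q n ≤ ((Real.cos (θ / 4) / Real.sin (θ / 4) : ℝ) : EReal)) :
    √(qOne q n) ≤ chainFactor c θ n := by
  rw [chainFactor_eq_quarter]
  unfold vOne at h
  split_ifs at h with hD
  · exact absurd (top_le_iff.1 h) (EReal.coe_ne_top _)
  rw [EReal.coe_le_coe_iff] at h
  obtain ⟨hs2, habs⟩ := sqrt_add_props (c := c n) h1
  have hr2 := Real.sq_sqrt h0.le
  have hr := Real.sqrt_pos.2 h0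
  set r := √(qOne q n)
  set s := √(c n ^ 2 + (1 - qOne q n))
  set S := Real.sin (θ / 4)
  set C := Real.cos (θ / 4)
  have hCS : C ^ 2 + S ^ 2 = 1 := Real.cos_sq_add_sin_sq _
  obtain ⟨ha1, ha2⟩ := abs_le.1 habs
  have hDpos : 0 < -c n + s := lt_of_le_of_ne (by linarith) (Ne.symm hD)
  rw [div_le_div_iff₀ hDpos hs] at h
  have hT : 0 ≤ (1 + r) * S := by positivity
  have hsq : ((1 + r) * S + c n * C) ^ 2 ≤ (s * C) ^ 2 := by
    apply sq_le_sq'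
    · nlinarith
    · nlinarith
  have key : 0 ≤ (1 + r) * (C ^ 2 - S ^ 2 - 2 * c n * S * C - r) := by
    have : (1 + r) * (C ^ 2 - S ^ 2 - 2 * c n * S * C - r) =
        (s * C) ^ 2 - ((1 + r) * S + c n * C) ^ 2 := by
      linear_combination -C ^ 2 * hs2 - C ^ 2 * hr2 + r * (1 + r) * hCS
    rw [this]; linarith
  have := nonneg_of_mul_nonneg_right key (by linarith)
  linarith

/-- Here the quadratic is (1 + r)x² - 2c_n x - (1 - r) ≤ 0, whose larger root is u_{1,n}. -/
lemma chainFactor_le_neg_sqrt_qOne {c : ℕ → ℝ} {n : ℕ} (h0 : 0 < qOne q n) (h1 : qOne q n ≤ 1)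
    {θ : ℝ} (hs : 0 < Real.sin (θ / 4)) (hc : 0 < Real.cos (θ / 4))
    (h : Real.cos (θ / 4) / Real.sin (θ / 4) ≤ uOne c q n) :
    chainFactor c θ n ≤ -√(qOne q n) := by
  rw [chainFactor_eq_quarter]
  unfold uOne at h
  obtain ⟨hs2, habs⟩ := sqrt_add_props (c := c n) h1
  have hr2 := Real.sq_sqrt h0.le
  have hr := Real.sqrt_pos.2 h0
  set r := √(qOne q n)
  set s := √(c n ^ 2 + (1 - qOne q n))
  set S := Real.sin (θ / 4)
  set C := Real.cos (θ / 4)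
  have hCS : C ^ 2 + S ^ 2 = 1 := Real.cos_sq_add_sin_sq _
  obtain ⟨ha1, ha2⟩ := abs_le.1 habs
  rw [div_le_div_iff₀ hs (by linarith)] at h
  have hT : 0 ≤ (1 + r) * C := by positivity
  have hsq : ((1 + r) * C - c n * S) ^ 2 ≤ (s * S) ^ 2 := by
    apply sq_le_sq'
    · nlinarith
    · nlinarith
  have key : 0 ≤ (1 + r) * (-(C ^ 2 - S ^ 2 - 2 * c n * S * C) - r) := by
    have : (1 + r) * (-(C ^ 2 - S ^ 2 - 2 * c n * S * C) - r) =
        (s * S) ^ 2 - ((1 + r) * C - c n * S) ^ 2 := by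
      linear_combination -S ^ 2 * hs2 - S ^ 2 * hr2 + r * (1 + r) * hCS
    rw [this]; linarith
  have := nonneg_of_mul_nonneg_right key (by linarith)
  linarith

lemma uOne_nonneg {c : ℕ → ℝ} {n : ℕ} (h1 : qOne q n ≤ 1) : 0 ≤ uOne c q n := by
  obtain ⟨-, habs⟩ := sqrt_add_props (c := c n) h1
  have := (abs_le.1 habs).1
  exact div_nonneg (by linarith) (by positivity)

/-- Cross-multiplied, this is 1 - r² < (1 + r)². The index n = 1 alone then yields ϑ₁ < ϑ₂. -/
lemma uOne_lt_vOne {c : ℕ → ℝ} {n : ℕ} (h0 : 0 < qOne q n) (h1 : qOne q n ≤ 1) :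
    (uOne c q n : EReal) < vOne c q n := by
  unfold vOne uOne
  split_ifs with hD
  · exact EReal.coe_lt_top _
  obtain ⟨hs2, habs⟩ := sqrt_add_props (c := c n) h1
  have hr := Real.sqrt_pos.2 h0
  obtain ⟨ha1, ha2⟩ := abs_le.1 habs
  have hDpos : 0 < -c n + √(c n ^ 2 + (1 - qOne q n)) :=
    lt_of_le_of_ne (by linarith) (Ne.symm hD)
  rw [EReal.coe_lt_coe_iff, div_lt_div_iff₀ (by linarith) hDpos]
  nlinarith

end Chain

/-! ### From signs of weights to arcs. -/

/-- The sign of the weight at a point of the circle other than 1 thus compares the two angles. -/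
lemma cotWeight_exp_cotAngle (l₀ l : ℝ) :
    cotWeight l₀ (Circle.exp (cotAngle l)) =
      2 * Real.sin (cotAngle l / 2) ^ 2 * (l₀ - l) := by
  have h : cotAngle l / 2 = Real.pi / 2 - Real.arctan l := by unfold cotAngle; ring
  have h2 : Real.cos (cotAngle l / 2) = l * Real.sin (cotAngle l / 2) := by
    rw [h, Real.cos_pi_div_two_sub, Real.sin_pi_div_two_sub,
      ← Real.tan_mul_cos (Real.cos_arctan_pos l).ne', Real.tan_arctan]
  have h3 : cotAngle l = 2 * (cotAngle l / 2) := by ring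
  have hre : (Circle.exp (cotAngle l) : ℂ).re = Real.cos (cotAngle l) := by
    rw [Circle.coe_exp, Complex.exp_ofReal_mul_I_re]
  have him : (Circle.exp (cotAngle l) : ℂ).im = Real.sin (cotAngle l) := by
    rw [Circle.coe_exp, Complex.exp_ofReal_mul_I_im]
  have e1 : Real.cos (cotAngle l) = 1 - 2 * Real.sin (cotAngle l / 2) ^ 2 := by
    conv_lhs => rw [h3, Real.cos_two_mul, Real.cos_sq']
    ring
  have e2 : Real.sin (cotAngle l) = 2 * l * Real.sin (cotAngle l / 2) ^ 2 := by
    conv_lhs => rw [h3, Real.sin_two_mul, h2]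
    ring
  rw [cotWeight_apply, hre, him, e1, e2]
  ring

lemma sin_cotAngle_half_pos (l : ℝ) : 0 < Real.sin (cotAngle l / 2) :=
  Real.sin_pos_of_pos_of_lt_pi (by linarith [cotAngle_pos l]) (by linarith [cotAngle_lt l])

lemma Circle.exists_exp_eq_of_ne_one {z : Circle} (hz : z ≠ 1) :
    ∃ θ : ℝ, 0 < θ ∧ θ < 2 * Real.pi ∧ z = Circle.exp θ := by
  have harg := Circle.exp_arg z
  have h1 := Complex.neg_pi_lt_arg (z : ℂ)
  have h2 := Complex.arg_le_pi (z : ℂ)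
  have hpi := Real.pi_pos
  rcases lt_trichotomy (Complex.arg (z : ℂ)) 0 with h | h | h
  · refine ⟨Complex.arg (z : ℂ) + 2 * Real.pi, by linarith, by linarith, ?_⟩
    rw [Circle.exp_add, Circle.exp_two_pi, mul_one, harg]
  · rw [h, Circle.exp_zero] at harg
    exact absurd harg.symm hz
  · exact ⟨_, h, by linarith, harg.symm⟩

lemma isClosed_closedArc (ϑ₁ ϑ₂ : ℝ) : IsClosed (closedArc ϑ₁ ϑ₂) := by
  have : closedArc ϑ₁ ϑ₂ = Circle.exp '' Set.Icc ϑ₁ ϑ₂ := by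
    ext z
    constructor
    · rintro ⟨θ, h1, h2, rfl⟩; exact ⟨θ, ⟨h1, h2⟩, rfl⟩
    · rintro ⟨θ, ⟨h1, h2⟩, rfl⟩; exact ⟨θ, h1, h2, rfl⟩
  rw [this]
  exact (isCompact_Icc.image Circle.exp.continuous).isClosed

lemma massFamily_zero_support_subset {μ : Measure Circle} {ϑ₁ ϑ₂ : ℝ}
    (h : ∀ᵐ z ∂μ, z ≠ 1 → z ∈ closedArc ϑ₁ ϑ₂) :
    (massFamily μ 0).support ⊆ closedArc ϑ₁ ϑ₂ := by
  refine Measure.support_subset_of_isClosed (isClosed_closedArc _ _) ?_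
  rw [massFamily, ENNReal.ofReal_zero, zero_smul, add_zero]
  refine Measure.ae_smul_measure ?_ _
  exact (ae_restrict_iff' (measurableSet_singleton 1).compl).2 h

/-- The angle `4 arccot a`. -/
lemma extCot_two_pi_sub (a : ℝ) :
    extCot ((2 * Real.pi - 4 * Real.arctan a) / 4) = (a : EReal) := by
  have h := Real.arctan_lt_pi_div_two a
  have e : (2 * Real.pi - 4 * Real.arctan a) / 4 = Real.pi / 2 - Real.arctan a := by ring
  rw [extCot, e, if_neg (by linarith), Real.cot_eq_cos_div_sin, Real.cos_pi_div_two_sub,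
    Real.sin_pi_div_two_sub, ← Real.tan_eq_sin_div_cos, Real.tan_arctan]

lemma cos_div_sin_eq_tan (x : ℝ) : Real.cos x / Real.sin x = Real.tan (Real.pi / 2 - x) := by
  rw [Real.tan_eq_sin_div_cos, Real.cos_pi_div_two_sub, Real.sin_pi_div_two_sub]

lemma lt_cos_div_sin_quarter {θ a : ℝ} (h0 : 0 < θ) (h : θ < 2 * Real.pi - 4 * Real.arctan a) :
    a < Real.cos (θ / 4) / Real.sin (θ / 4) := by
  have h1 := Real.neg_pi_div_two_lt_arctan a
  rw [cos_div_sin_eq_tan]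
  conv_lhs => rw [← Real.tan_arctan a]
  exact Real.tan_lt_tan_of_lt_of_lt_pi_div_two h1 (by linarith) (by linarith)

lemma cos_div_sin_quarter_lt {θ a : ℝ} (h0 : θ < 2 * Real.pi)
    (h : 2 * Real.pi - 4 * Real.arctan a < θ) :
    Real.cos (θ / 4) / Real.sin (θ / 4) < a := by
  have h1 := Real.arctan_lt_pi_div_two a
  rw [cos_div_sin_eq_tan]
  conv_rhs => rw [← Real.tan_arctan a]
  exact Real.tan_lt_tan_of_lt_of_lt_pi_div_two (by linarith) h1 (by linarith)

section Arc

variable {μ : Measure Circle} {Φ : ℕ → ℂ[X]} {c d q : ℕ → ℝ}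

lemma sin_cos_quarter_pos {θ : ℝ} (h0 : 0 < θ) (h1 : θ < 2 * Real.pi) :
    0 < Real.sin (θ / 4) ∧ 0 < Real.cos (θ / 4) :=
  ⟨Real.sin_pos_of_pos_of_lt_pi (by linarith) (by linarith),
    Real.cos_pos_of_mem_Ioo ⟨by linarith [Real.pi_pos], by linarith⟩⟩

lemma IsMonicOPUC.ae_le_angle (hμ : IsNontrivialProbability μ)
    (hΦ : IsMonicOPUC μ Φ) (hc : ∀ n, 1 ≤ n → c n = cCoeff (verblunsky Φ) n)
    (hd : ∀ n, 1 ≤ n → d (n + 1) = (1 - gCoeff (verblunsky Φ) n) * gCoeff (verblunsky Φ) (n + 1))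
    (hq : IsScalingSeq d q) {a : ℝ} (ha : 0 < a) (hv : ∀ n, 1 ≤ n → vOne c q n ≤ (a : EReal)) :
    ∀ᵐ z ∂μ, ∀ θ : ℝ, 0 < θ → θ < 2 * Real.pi → z = Circle.exp θ →
      2 * Real.pi - 4 * Real.arctan a ≤ θ := by
  have ha1 := Real.arctan_lt_pi_div_two a
  have ha2 := Real.arctan_pos.2 ha
  obtain ⟨l₀, hl₀⟩ := exists_cotAngle_eq (θ := 2 * Real.pi - 4 * Real.arctan a)
    (by linarith) (by linarith)
  have h := hΦ.ae_cotWeight_nonneg hμ hc hd (l₀ := l₀) fun l hl n => by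
    rw [← cotAngle_lt_cotAngle, hl₀] at hl
    obtain ⟨hs, hcos⟩ := sin_cos_quarter_pos (cotAngle_pos l) (cotAngle_lt l)
    refine hq.chainPoly_ne_zero_of_le (fun m hm => ?_) n
    refine sqrt_qOne_le_chainFactor (hq.qOne_pos hm) (hq.qOne_le_one hm) hs hcos
      ((hv m hm).trans ?_)
    exact_mod_cast (lt_cos_div_sin_quarter (cotAngle_pos l) hl).le
  filter_upwards [h] with z hz θ h0 h1 hzθ
  obtain ⟨l, rfl⟩ := exists_cotAngle_eq h0 h1
  rw [hzθ, cotWeight_exp_cotAngle] at hz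
  have hs := sin_cotAngle_half_pos l
  have := nonneg_of_mul_nonneg_right hz (by positivity)
  rw [← hl₀]
  exact not_lt.1 fun hcon => by linarith [cotAngle_lt_cotAngle.1 hcon]

lemma IsMonicOPUC.ae_angle_le (hμ : IsNontrivialProbability μ)
    (hΦ : IsMonicOPUC μ Φ) (hc : ∀ n, 1 ≤ n → c n = cCoeff (verblunsky Φ) n)
    (hd : ∀ n, 1 ≤ n → d (n + 1) = (1 - gCoeff (verblunsky Φ) n) * gCoeff (verblunsky Φ) (n + 1))
    (hq : IsScalingSeq d q) {b : ℝ} (hb : 0 ≤ b) (hu : ∀ n, 1 ≤ n → b ≤ uOne c q n) :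
    ∀ᵐ z ∂μ, ∀ θ : ℝ, 0 < θ → θ < 2 * Real.pi → z = Circle.exp θ →
      θ ≤ 2 * Real.pi - 4 * Real.arctan b := by
  -- For b = 0 the bound is 2π, which is not a `cotAngle` but holds trivially.
  rcases eq_or_lt_of_le hb with rfl | hb
  · refine Filter.Eventually.of_forall fun z θ _ h1 _ => ?_
    rw [Real.arctan_zero]; linarith
  have hb1 := Real.arctan_lt_pi_div_two b
  have hb2 := Real.arctan_pos.2 hb
  obtain ⟨l₀, hl₀⟩ := exists_cotAngle_eq (θ := 2 * Real.pi - 4 * Real.arctan b)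
    (by linarith) (by linarith)
  have h := hΦ.ae_cotWeight_nonpos hμ hc hd (l₀ := l₀) fun l hl n => by
    rw [← cotAngle_lt_cotAngle, hl₀] at hl
    obtain ⟨hs, hcos⟩ := sin_cos_quarter_pos (cotAngle_pos l) (cotAngle_lt l)
    refine hq.chainPoly_ne_zero_of_le_neg (fun m hm => ?_) n
    exact chainFactor_le_neg_sqrt_qOne (hq.qOne_pos hm) (hq.qOne_le_one hm) hs hcos
      ((cos_div_sin_quarter_lt (cotAngle_lt l) hl).le.trans (hu m hm))
  filter_upwards [h] with z hz θ h0 h1 hzθ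
  obtain ⟨l, rfl⟩ := exists_cotAngle_eq h0 h1
  rw [hzθ, cotWeight_exp_cotAngle] at hz
  have hs := sin_cotAngle_half_pos l
  have : l₀ - l ≤ 0 := nonpos_of_mul_nonpos_right hz (by positivity)
  rw [← hl₀]
  exact not_lt.1 fun hcon => by linarith [cotAngle_lt_cotAngle.1 hcon]

end Arc

end

theorem mainTheorem7 (c d q : ℕ → ℝ) (hd : IsNonSPChainSeq d)
    (μ : Measure Circle) (hμ : IsNontrivialProbability μ) (hcd : HasCDParametrization μ c d)
    (hq : IsScalingSeq d q) :
    ∃ ϑ₁ ϑ₂ : ℝ, 0 ≤ ϑ₁ ∧ ϑ₁ < ϑ₂ ∧ ϑ₂ ≤ 2 * Real.pi ∧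
      extCot (ϑ₁ / 4) = ⨆ (n : ℕ) (_ : 1 ≤ n), vOne c q n ∧
      extCot (ϑ₂ / 4) = ⨅ (n : ℕ) (_ : 1 ≤ n), (uOne c q n : EReal) ∧
      (massFamily μ 0).support ⊆ closedArc ϑ₁ ϑ₂ := by
  obtain ⟨Φ, hΦ, hform⟩ := hcd
  have hc : ∀ n, 1 ≤ n → c n = cCoeff (verblunsky Φ) n := fun n hn => (hform n hn).1
  have hd' := fun n hn => (hform n hn).2
  set V : EReal := ⨆ (n : ℕ) (_ : 1 ≤ n), vOne c q n with hV
  set U : EReal := ⨅ (n : ℕ) (_ : 1 ≤ n), (uOne c q n : EReal) with hU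
  have hvV : ∀ n, 1 ≤ n → vOne c q n ≤ V := fun n hn => le_iSup₂ (f := fun n _ => vOne c q n) n hn
  have hUu : ∀ n, 1 ≤ n → U ≤ (uOne c q n : EReal) := fun n hn =>
    iInf₂_le (f := fun n _ => (uOne c q n : EReal)) n hn
  have hU0 : 0 ≤ U := le_iInf₂ fun n hn => by exact_mod_cast uOne_nonneg (hq.qOne_le_one hn)
  have hUV : U < V := (hUu 1 le_rfl).trans_lt
    ((uOne_lt_vOne (hq.qOne_pos le_rfl) (hq.qOne_le_one le_rfl)).trans_le (hvV 1 le_rfl))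
  -- 0 ≤ U < V makes U finite; only V can be infinite, and then ϑ₁ = 0 imposes no lower constraint.
  obtain ⟨b, hb⟩ : ∃ b : ℝ, U = b :=
    ⟨U.toReal, (EReal.coe_toReal (hUV.trans_le le_top).ne
      (lt_of_lt_of_le EReal.bot_lt_zero hU0).ne').symm⟩
  have hb0 : 0 ≤ b := by rw [hb] at hU0; exact_mod_cast hU0
  have hbu : ∀ n, 1 ≤ n → b ≤ uOne c q n := fun n hn => by
    have := hUu n hn
    rw [hb] at this
    exact_mod_cast this
  have hbpi := Real.arctan_lt_pi_div_two b
  have hbnn := Real.arctan_nonneg.2 hb0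
  have hupper := hΦ.ae_angle_le hμ hc hd' hq hb0 hbu
  have conclude : ∀ ϑ₁ : ℝ, (∀ᵐ z ∂μ, ∀ θ : ℝ, 0 < θ → θ < 2 * Real.pi → z = Circle.exp θ →
      ϑ₁ ≤ θ) →
      (massFamily μ 0).support ⊆ closedArc ϑ₁ (2 * Real.pi - 4 * Real.arctan b) := by
    intro ϑ₁ hlower
    apply massFamily_zero_support_subset
    filter_upwards [hlower, hupper] with z h1 h2 hz
    obtain ⟨θ, h3, h4, h5⟩ := Circle.exists_exp_eq_of_ne_one hz
    exact ⟨θ, h1 θ h3 h4 h5, h2 θ h3 h4 h5, h5⟩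
  rcases eq_or_ne V ⊤ with hVtop | hVtop
  · refine ⟨0, 2 * Real.pi - 4 * Real.arctan b, le_rfl, by linarith, by linarith, ?_, ?_, ?_⟩
    · rw [hVtop, extCot, zero_div, if_pos rfl]
    · rw [extCot_two_pi_sub, hb]
    · exact conclude 0 (Filter.Eventually.of_forall fun z θ h0 _ _ => h0.le)
  · obtain ⟨a, ha⟩ : ∃ a : ℝ, V = a := ⟨V.toReal, (EReal.coe_toReal hVtop
      ((bot_le.trans_lt hUV).ne')).symm⟩
    have hba : b < a := by rw [ha, hb] at hUV; exact_mod_cast hUV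
    have ha1 := Real.arctan_lt_pi_div_two a
    have hab := Real.arctan_lt_arctan_iff.2 hba
    refine ⟨2 * Real.pi - 4 * Real.arctan a, 2 * Real.pi - 4 * Real.arctan b, by linarith,
      by linarith, by linarith, ?_, ?_, ?_⟩
    · rw [extCot_two_pi_sub, ha]
    · rw [extCot_two_pi_sub, hb]
    · exact conclude _ (hΦ.ae_le_angle hμ hc hd' hq (hb0.trans_lt hba) (fun n hn => ha ▸ hvV n hn))
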